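/- Let $\mathcal X_0,\mathcal X_1,\mathcal X_2$ be finite alphabets and let $(X_0,X_1,X_2)$ have joint probability mass function $p$ on $\mathcal X_0\times\mathcal X_1\times\mathcal X_2$. Let $(X_{0,t},X_{1,t},X_{2,t})_{t\ge 1}$ be i.i.d. copies. In the 2-sink, 1-helper network, source node $E_i$ observes $X_i^n$ ($i=0,1,2$). A code of length $n$ with index-set sizes $L_{0,12},L_{0,1},L_{0,2},L_1,L_2$ (positive integers) consists of encoders $$f_0:\mathcal X_0^n\to I_{L_{0,12}}\times I_{L_{0,1}}\times I_{L_{0,2}},\qquad f_1:\mathcal X_1^n\to I_{L_1},\qquad f_2:\mathcal X_2^n\to I_{L_2},$$ where $I_L=\{1,\dots,L\}$, producing indices $(T_{0,12},T_{0,1},T_{0,2}),T_1,T_2$, and of decoders $g_1:I_{L_{0,12}}\times I_{L_{0,1}}\times I_{L_1}\to\mathcal X_1^n$ at sink $S_1$ and $g_2:I_{L_{0,12}}\times I_{L_{0,2}}\times I_{L_2}\to\mathcal X_2^n$ at sink $S_2$. Its error probability is $$P_e=\tfrac12\bigl[P\bigl(X_1^n\ne g_1(T_{0,12},T_{0,1},T_1)\bigr)+P\bigl(X_2^n\ne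 g_2(T_{0,12},T_{0,2},T_2)\bigr)\bigr].$$ A rate tuple $(R_{0,12},R_{0,1},R_{0,2},R_1,R_2)\in\mathbb R^5$ is achievable if for every $\eta>0$ and $0<\epsilon<1$ there is, for all sufficiently large $n$, a code of length $n$ with $P_e<\epsilon$ and $\frac1n\log_2 L_k\le R_k+\eta$ for each of the five packets $k$. The complete rate region is the set of all achievable rate tuples. Let $(U_0,U_1,U_2)$ be random variables with values in arbitrary finite sets $\mathcal U_0,\mathcal U_1,\mathcal U_2$, jointly distributed with $(X_0,X_1,X_2)$ such that the Markov chains $$X_1\leftrightarrow X_0\leftrightarrow(U_0,U_1,U_2),\qquad X_2\leftrightarrow X_0\leftrightarrow(U_0,U_1,U_2)$$ hold. Then every rate tuple satisfying $$R_{0,12}\ge I(X_0;U_0),\quad R_{0,1}\ge I(X_0;U_1|U_0),\quad R_{0,2}\ge I(X_0;U_2|U_0),$$ $$R_1\ge H(X_1|U_0,U_1),\quad R_2\ge H(X_2|U_0,U_2)$$ is achievable (entropies and informations in bits). Moreover, the complete rate region equals the closure in $\mathbb R^5$ of the union, over all such $(U_0,U_1,U_2)$, of the sets of rate tuples satisfying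 these five inequalities. -/

import Mathlib

namespace HelperDIR

/-! ### Finite probability: laws, Markov chains and information measures (in bits)

A finite probability space is a finite type `Ω` with a mass function `q ∈ stdSimplex ℝ Ω`;
a random variable is a function on `Ω`. -/

section Information

variable {Ω A B C : Type*} [Fintype Ω]

open Classical in
/-- The probability `P(X = a)` under the mass function `q`. -/
noncomputable def law (q : Ω → ℝ) (X : Ω → A) (a : A) : ℝ :=
  ∑ ω, if X ω = a then q ω else 0

/-- The Markov chain `X ↔ Y ↔ Z`: `p(x,y,z) p(y) = p(x,y) p(y,z)` for all `x, y, z`. -/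
def IsMarkovChain (q : Ω → ℝ) (X : Ω → A) (Y : Ω → B) (Z : Ω → C) : Prop :=
  ∀ x y z, law q (fun ω => (X ω, Y ω, Z ω)) (x, y, z) * law q Y y =
    law q (fun ω => (X ω, Y ω)) (x, y) * law q (fun ω => (Y ω, Z ω)) (y, z)

variable [Fintype A] [Fintype B] [Fintype C]

/-- Conditional entropy `H(X | Y) = - ∑ p(x,y) log₂ p(x|y)`. Terms with `p(x,y) = 0` vanish. -/
noncomputable def condEntropy (q : Ω → ℝ) (X : Ω → A) (Y : Ω → B) : ℝ :=
  -∑ x, ∑ y, law q (fun ω => (X ω, Y ω)) (x, y) *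
    Real.logb 2 (law q (fun ω => (X ω, Y ω)) (x, y) / law q Y y)

/-- Mutual information `I(X; Y) = ∑ p(x,y) log₂ (p(x,y) / (p(x) p(y)))`. -/
noncomputable def mutualInfo (q : Ω → ℝ) (X : Ω → A) (Y : Ω → B) : ℝ :=
  ∑ x, ∑ y, law q (fun ω => (X ω, Y ω)) (x, y) *
    Real.logb 2 (law q (fun ω => (X ω, Y ω)) (x, y) / (law q X x * law q Y y))

/-- Conditional mutual information
`I(X; Y | Z) = ∑ p(x,y,z) log₂ (p(x,y|z) / (p(x|z) p(y|z)))`. -/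
noncomputable def condMutualInfo (q : Ω → ℝ) (X : Ω → A) (Y : Ω → B) (Z : Ω → C) : ℝ :=
  ∑ x, ∑ y, ∑ z, law q (fun ω => (X ω, Y ω, Z ω)) (x, y, z) *
    Real.logb 2 ((law q (fun ω => (X ω, Y ω, Z ω)) (x, y, z) / law q Z z) /
      ((law q (fun ω => (X ω, Z ω)) (x, z) / law q Z z) *
        (law q (fun ω => (Y ω, Z ω)) (y, z) / law q Z z)))

end Information

/-! ### The network: codes and achievable rates -/

/-- The five packets. `p012`, `p01`, `p02` go from `E₀` to both sinks, to `S₁` only and to `S₂`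
only; `p1` goes from `E₁` to `S₁` and `p2` from `E₂` to `S₂`. -/
inductive Packet
  | p012
  | p01
  | p02
  | p1
  | p2

section Codes

variable {𝒳₀ 𝒳₁ 𝒳₂ : Type*}

/-- A block code of length `n`. Packet `k` carries an index from a set with `L k` elements
(`L k` is positive as soon as the alphabets are nonempty, since the encoders are total). -/
structure Code (n : ℕ) (𝒳₀ 𝒳₁ 𝒳₂ : Type*) where
  /-- sizes of the index sets -/
  L : Packet → ℕ
  /-- encoder at `E₀` -/
  enc₀ : (Fin n → 𝒳₀) → Fin (L .p012) × Fin (L .p01) × Fin (L .p02)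
  /-- encoder at `E₁` -/
  enc₁ : (Fin n → 𝒳₁) → Fin (L .p1)
  /-- encoder at `E₂` -/
  enc₂ : (Fin n → 𝒳₂) → Fin (L .p2)
  /-- decoder at `S₁`, which receives the packets `p012`, `p01`, `p1` -/
  dec₁ : Fin (L .p012) × Fin (L .p01) × Fin (L .p1) → (Fin n → 𝒳₁)
  /-- decoder at `S₂`, which receives the packets `p012`, `p02`, `p2` -/
  dec₂ : Fin (L .p012) × Fin (L .p02) × Fin (L .p2) → (Fin n → 𝒳₂)

/-- The reconstruction of the `X₁` sequence at `S₁` when the sources emit `x`. -/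
def Code.est₁ {n : ℕ} (c : Code n 𝒳₀ 𝒳₁ 𝒳₂) (x : Fin n → 𝒳₀ × 𝒳₁ × 𝒳₂) : Fin n → 𝒳₁ :=
  let t := c.enc₀ fun i => (x i).1
  c.dec₁ (t.1, t.2.1, c.enc₁ fun i => (x i).2.1)

/-- The reconstruction of the `X₂` sequence at `S₂` when the sources emit `x`. -/
def Code.est₂ {n : ℕ} (c : Code n 𝒳₀ 𝒳₁ 𝒳₂) (x : Fin n → 𝒳₀ × 𝒳₁ × 𝒳₂) : Fin n → 𝒳₂ :=
  let t := c.enc₀ fun i => (x i).1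
  c.dec₂ (t.1, t.2.2, c.enc₂ fun i => (x i).2.2)

variable [Fintype 𝒳₀] [Fintype 𝒳₁] [Fintype 𝒳₂]

open Classical in
/-- The probability of error, averaged over the two sinks, when the triples
`(X₀, X₁, X₂)` are i.i.d. with mass function `p`. -/
noncomputable def Code.errorProb {n : ℕ} (c : Code n 𝒳₀ 𝒳₁ 𝒳₂) (p : 𝒳₀ × 𝒳₁ × 𝒳₂ → ℝ) : ℝ :=
  (1 / 2) *
    ((∑ x : Fin n → 𝒳₀ × 𝒳₁ × 𝒳₂,
        if (fun i => (x i).2.1) ≠ c.est₁ x then ∏ i, p (x i) else 0) +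
      ∑ x : Fin n → 𝒳₀ × 𝒳₁ × 𝒳₂,
        if (fun i => (x i).2.2) ≠ c.est₂ x then ∏ i, p (x i) else 0)

/-- The rate tuple `R` is achievable: for all `η > 0` and `0 < ε < 1` and all sufficiently large
`n` there is a code of length `n` whose rates exceed those of `R` by at most `η`, with error
probability less than `ε`. -/
def Achievable (p : 𝒳₀ × 𝒳₁ × 𝒳₂ → ℝ) (R : Packet → ℝ) : Prop :=
  ∀ η : ℝ, 0 < η → ∀ ε : ℝ, 0 < ε → ε < 1 → ∀ᶠ n : ℕ in Filter.atTop,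
    ∃ c : Code n 𝒳₀ 𝒳₁ 𝒳₂,
      (∀ k, (1 / (n : ℝ)) * Real.logb 2 (c.L k) ≤ R k + η) ∧ c.errorProb p < ε

/-- The complete rate region: all achievable rate tuples. -/
def rateRegion (p : 𝒳₀ × 𝒳₁ × 𝒳₂ → ℝ) : Set (Packet → ℝ) :=
  {R | Achievable p R}

end Codes

/-! ### The single-letter region -/

section Region

variable {𝒳₀ 𝒳₁ 𝒳₂ 𝒰₀ 𝒰₁ 𝒰₂ : Type*} [Fintype 𝒳₀] [Fintype 𝒳₁] [Fintype 𝒳₂]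
  [Fintype 𝒰₀] [Fintype 𝒰₁] [Fintype 𝒰₂]

/-- `q` is a joint mass function of `((X₀, X₁, X₂), (U₀, U₁, U₂))` such that `(X₀, X₁, X₂)` has
mass function `p`, and `X₁ ↔ X₀ ↔ (U₀, U₁, U₂)` and `X₂ ↔ X₀ ↔ (U₀, U₁, U₂)`. -/
def IsAuxiliary (p : 𝒳₀ × 𝒳₁ × 𝒳₂ → ℝ)
    (q : (𝒳₀ × 𝒳₁ × 𝒳₂) × (𝒰₀ × 𝒰₁ × 𝒰₂) → ℝ) : Prop :=
  q ∈ stdSimplex ℝ ((𝒳₀ × 𝒳₁ × 𝒳₂) × (𝒰₀ × 𝒰₁ × 𝒰₂)) ∧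
    (∀ x, ∑ u, q (x, u) = p x) ∧
    IsMarkovChain q (fun ω => ω.1.2.1) (fun ω => ω.1.1) (fun ω => ω.2) ∧
    IsMarkovChain q (fun ω => ω.1.2.2) (fun ω => ω.1.1) (fun ω => ω.2)

/-- The rate tuples that satisfy the five information constraints for the joint law `q` of
`((X₀, X₁, X₂), (U₀, U₁, U₂))`. -/
def infoRegion (q : (𝒳₀ × 𝒳₁ × 𝒳₂) × (𝒰₀ × 𝒰₁ × 𝒰₂) → ℝ) : Set (Packet → ℝ) :=
  let X₀ : (𝒳₀ × 𝒳₁ × 𝒳₂) × (𝒰₀ × 𝒰₁ × 𝒰₂) → 𝒳₀ := fun ω => ω.1.1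
  let X₁ : (𝒳₀ × 𝒳₁ × 𝒳₂) × (𝒰₀ × 𝒰₁ × 𝒰₂) → 𝒳₁ := fun ω => ω.1.2.1
  let X₂ : (𝒳₀ × 𝒳₁ × 𝒳₂) × (𝒰₀ × 𝒰₁ × 𝒰₂) → 𝒳₂ := fun ω => ω.1.2.2
  let U₀ : (𝒳₀ × 𝒳₁ × 𝒳₂) × (𝒰₀ × 𝒰₁ × 𝒰₂) → 𝒰₀ := fun ω => ω.2.1
  let U₁ : (𝒳₀ × 𝒳₁ × 𝒳₂) × (𝒰₀ × 𝒰₁ × 𝒰₂) → 𝒰₁ := fun ω => ω.2.2.1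
  let U₂ : (𝒳₀ × 𝒳₁ × 𝒳₂) × (𝒰₀ × 𝒰₁ × 𝒰₂) → 𝒰₂ := fun ω => ω.2.2.2
  {R | R .p012 ≥ mutualInfo q X₀ U₀ ∧
    R .p01 ≥ condMutualInfo q X₀ U₁ U₀ ∧
    R .p02 ≥ condMutualInfo q X₀ U₂ U₀ ∧
    R .p1 ≥ condEntropy q X₁ (fun ω => (U₀ ω, U₁ ω)) ∧
    R .p2 ≥ condEntropy q X₂ (fun ω => (U₀ ω, U₂ ω))}

/-- The union of the regions `infoRegion q` over all finite sets `𝒰₀, 𝒰₁, 𝒰₂` and all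
auxiliary joint laws `q`. -/
def infoRegionUnion (p : 𝒳₀ × 𝒳₁ × 𝒳₂ → ℝ) : Set (Packet → ℝ) :=
  {R | ∃ (𝒱₀ 𝒱₁ 𝒱₂ : Type) (_ : Fintype 𝒱₀) (_ : Fintype 𝒱₁) (_ : Fintype 𝒱₂)
    (q : (𝒳₀ × 𝒳₁ × 𝒳₂) × (𝒱₀ × 𝒱₁ × 𝒱₂) → ℝ), IsAuxiliary p q ∧ R ∈ infoRegion q}

end Region

end HelperDIR

/-!
Achievability. `E₀` covers `X₀ⁿ` by a codebook for `U₀ⁿ`, and then, given the chosen `U₀ⁿ`, by one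
codebook for `U₁ⁿ` and one for `U₂ⁿ`; it sends the three codebook indices. `E₁` and `E₂` send
random bin numbers, and sink `Sᵢ` looks in the received bin for a sequence that is likely given
its two codewords. The Markov chains make the codewords chosen from `X₀ⁿ` alone work for `X₁ⁿ` and
`X₂ⁿ`. All this is done in one shot, with thresholds on probability ratios in place of typical
sets; the exponents then come from the weak law of large numbers.

Converse. With `J` a uniform time index, put `U₀ = (J, T₀₁₂, X₀^{J-1})`, `U₁ = T₀₁`, `U₂ = T₀₂` for
the indices `T` of a code. The chain rule turns the rates of the three packets of `E₀` into
`I(X₀; U₀)` and `I(X₀; Uᵢ | U₀)`. Fano's inequality bounds the rate of `Eᵢ` by `H(Xᵢ | ·)` given the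
past of `Xᵢ`, and replacing that past by the past of `X₀` only lowers this entropy, since `Xᵢ^{J-1}`
is independent of everything else given `X₀^{J-1}`. Letting the error probability tend to zero puts
every achievable tuple in the closure, and the set of achievable tuples is closed.
-/

namespace HelperDIR

section Law

variable {Ω A B C : Type*} [Fintype Ω]

open Classical in
/-- The probability of the event `E` under the mass function `q`. -/
noncomputable def prob (q : Ω → ℝ) (E : Ω → Prop) : ℝ :=
  ∑ ω, if E ω then q ω else 0

theorem prob_nonneg {q : Ω → ℝ} (hq : ∀ ω, 0 ≤ q ω) (E : Ω → Prop) : 0 ≤ prob q E :=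
  Finset.sum_nonneg fun ω _ => by split_ifs <;> simp [hq ω]

theorem prob_congr (q : Ω → ℝ) {E F : Ω → Prop} (h : ∀ ω, E ω ↔ F ω) : prob q E = prob q F :=
  congrArg (prob q) (funext fun ω => propext (h ω))

theorem prob_mono {q : Ω → ℝ} (hq : ∀ ω, 0 ≤ q ω) {E F : Ω → Prop}
    (h : ∀ ω, 0 < q ω → E ω → F ω) : prob q E ≤ prob q F := by
  refine Finset.sum_le_sum fun ω _ => ?_
  rcases (hq ω).eq_or_lt with h0 | h0
  · simp [← h0]
  · by_cases hE : E ω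
    · simp [hE, h ω h0 hE]
    · rw [if_neg hE]
      split_ifs <;> simp [h0.le]

theorem prob_or_le {q : Ω → ℝ} (hq : ∀ ω, 0 ≤ q ω) (E F : Ω → Prop) :
    prob q (fun ω => E ω ∨ F ω) ≤ prob q E + prob q F := by
  unfold prob
  rw [← Finset.sum_add_distrib]
  refine Finset.sum_le_sum fun ω _ => ?_
  by_cases hE : E ω <;> by_cases hF : F ω <;> simp [hE, hF, hq ω]

theorem prob_eq_sum_mul (q : Ω → ℝ) (E : Ω → Prop) [DecidablePred E] :
    prob q E = ∑ ω, q ω * if E ω then 1 else 0 :=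
  Finset.sum_congr rfl fun ω _ => by by_cases h : E ω <;> simp [h]

theorem prob_add_prob_not (q : Ω → ℝ) (E : Ω → Prop) :
    prob q E + prob q (fun ω => ¬ E ω) = ∑ ω, q ω := by
  unfold prob
  rw [← Finset.sum_add_distrib]
  exact Finset.sum_congr rfl fun ω _ => by by_cases h : E ω <;> simp [h]

theorem prob_exists_le {ι : Type*} [Fintype ι] {q : Ω → ℝ} (hq : ∀ ω, 0 ≤ q ω)
    (E : ι → Ω → Prop) : prob q (fun ω => ∃ i, E i ω) ≤ ∑ i, prob q (E i) := by
  classical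
  simp only [prob_eq_sum_mul]
  rw [Finset.sum_comm]
  simp only [← Finset.mul_sum]
  refine Finset.sum_le_sum fun ω _ => mul_le_mul_of_nonneg_left ?_ (hq ω)
  split_ifs with h
  · obtain ⟨i, hi⟩ := h
    simpa [hi] using Finset.single_le_sum (f := fun j => if E j ω then (1 : ℝ) else 0)
      (fun j _ => by split_ifs <;> simp) (Finset.mem_univ i)
  · exact Finset.sum_nonneg fun j _ => by split_ifs <;> simp

theorem sum_mul_prob_comm {ι : Type*} [Fintype ι] (r : ι → ℝ) (q : Ω → ℝ) (E : ι → Ω → Prop) :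
    ∑ i, r i * prob q (E i) = ∑ ω, q ω * prob r fun i => E i ω := by
  classical
  simp only [prob_eq_sum_mul, Finset.mul_sum]
  rw [Finset.sum_comm]
  simp only [mul_left_comm]

theorem sum_mul_le_sum_mul_of_pos {q : Ω → ℝ} (hq : ∀ ω, 0 ≤ q ω) {f g : Ω → ℝ}
    (h : ∀ ω, 0 < q ω → f ω ≤ g ω) : ∑ ω, q ω * f ω ≤ ∑ ω, q ω * g ω := by
  refine Finset.sum_le_sum fun ω _ => ?_
  rcases (hq ω).eq_or_lt with h0 | h0
  · simp [← h0]
  · exact mul_le_mul_of_nonneg_left (h ω h0) h0.le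

theorem sum_mul_eq_sum_mul_of_pos {q : Ω → ℝ} (hq : ∀ ω, 0 ≤ q ω) {f g : Ω → ℝ}
    (h : ∀ ω, 0 < q ω → f ω = g ω) : ∑ ω, q ω * f ω = ∑ ω, q ω * g ω :=
  (sum_mul_le_sum_mul_of_pos hq fun ω hω => (h ω hω).le).antisymm
    (sum_mul_le_sum_mul_of_pos hq fun ω hω => (h ω hω).ge)

theorem mul_prob_lt_le_sum_mul {q : Ω → ℝ} (hq : ∀ ω, 0 ≤ q ω) {f : Ω → ℝ}
    (hf : ∀ ω, 0 < q ω → 0 ≤ f ω) (δ : ℝ) :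
    δ * prob q (fun ω => δ < f ω) ≤ ∑ ω, q ω * f ω := by
  classical
  rw [prob_eq_sum_mul, Finset.mul_sum]
  simp only [mul_left_comm δ]
  refine sum_mul_le_sum_mul_of_pos hq fun ω hω => ?_
  split_ifs with h
  · linarith
  · simpa using hf ω hω

theorem law_nonneg {q : Ω → ℝ} (hq : ∀ ω, 0 ≤ q ω) (X : Ω → A) (a : A) : 0 ≤ law q X a :=
  prob_nonneg hq _

theorem law_le_law {q : Ω → ℝ} (hq : ∀ ω, 0 ≤ q ω) {X : Ω → A} {Y : Ω → B} {a : A} {b : B}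
    (h : ∀ ω, X ω = a → Y ω = b) : law q X a ≤ law q Y b :=
  prob_mono hq fun ω _ => h ω

theorem law_congr (q : Ω → ℝ) {X : Ω → A} {Y : Ω → B} {a : A} {b : B}
    (h : ∀ ω, X ω = a ↔ Y ω = b) : law q X a = law q Y b :=
  prob_congr q h

theorem law_swap (q : Ω → ℝ) (X : Ω → A) (Y : Ω → B) (a : A) (b : B) :
    law q (fun ω => (X ω, Y ω)) (a, b) = law q (fun ω => (Y ω, X ω)) (b, a) :=
  law_congr q fun ω => by simp [and_comm]

theorem law_pos {q : Ω → ℝ} (hq : ∀ ω, 0 ≤ q ω) (X : Ω → A) {ω : Ω} (h : 0 < q ω) :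
    0 < law q X (X ω) :=
  Finset.sum_pos' (fun ω' _ => by split_ifs <;> simp [hq ω'])
    ⟨ω, Finset.mem_univ ω, by simpa using h⟩

theorem sum_law_mul [Fintype A] (q : Ω → ℝ) (X : Ω → A) (f : A → ℝ) :
    ∑ a, law q X a * f a = ∑ ω, q ω * f (X ω) := by
  classical
  simp only [law, Finset.sum_mul, ite_mul, zero_mul]
  rw [Finset.sum_comm]
  exact Finset.sum_congr rfl fun ω _ => by simp

theorem sum_law [Fintype A] (q : Ω → ℝ) (X : Ω → A) : ∑ a, law q X a = ∑ ω, q ω := by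
  simpa using sum_law_mul q X fun _ => 1

theorem prob_law [Fintype A] (q : Ω → ℝ) (X : Ω → A) (E : A → Prop) :
    prob (law q X) E = prob q fun ω => E (X ω) := by
  classical
  rw [prob_eq_sum_mul, prob_eq_sum_mul, sum_law_mul]

theorem law_law [Fintype A] (q : Ω → ℝ) (X : Ω → A) (f : A → B) :
    law (law q X) f = law q fun ω => f (X ω) :=
  funext fun b => prob_law q X fun a => f a = b

theorem law_id (q : Ω → ℝ) : law q (fun ω => ω) = q := by
  classical
  funext ω
  simp [law]

theorem prob_law_pair_left [Fintype B] (q : Ω → ℝ) (X : Ω → A) (Y : Ω → B) (a : A)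
    (E : B → Prop) :
    prob (fun b => law q (fun ω => (X ω, Y ω)) (a, b)) E = prob q fun ω => X ω = a ∧ E (Y ω) := by
  classical
  have hmask : (fun b => law q (fun ω => (X ω, Y ω)) (a, b)) =
      law (fun ω => if X ω = a then q ω else 0) Y :=
    funext fun b => Finset.sum_congr rfl fun ω _ => by
      by_cases hX : X ω = a <;> simp [hX]
  rw [hmask, prob_law]
  exact Finset.sum_congr rfl fun ω _ => by by_cases hX : X ω = a <;> simp [hX]

theorem sum_law_pair_left [Fintype B] (q : Ω → ℝ) (X : Ω → A) (Y : Ω → B) (a : A) :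
    ∑ b, law q (fun ω => (X ω, Y ω)) (a, b) = law q X a := by
  calc ∑ b, law q (fun ω => (X ω, Y ω)) (a, b)
      = prob (fun b => law q (fun ω => (X ω, Y ω)) (a, b)) fun _ => True := by simp [prob]
    _ = prob q fun ω => X ω = a ∧ True := prob_law_pair_left q X Y a _
    _ = law q X a := prob_congr q fun ω => by simp

theorem sum_law_pair_right [Fintype A] (q : Ω → ℝ) (X : Ω → A) (Y : Ω → B) (b : B) :
    ∑ a, law q (fun ω => (X ω, Y ω)) (a, b) = law q Y b := by
  simp only [law_swap q X Y, sum_law_pair_left]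

theorem IsMarkovChain.comp_right [Finite C] {D : Type*} {q : Ω → ℝ} {X : Ω → A} {Y : Ω → B}
    {Z : Ω → C} (h : IsMarkovChain q X Y Z) (f : C → D) :
    IsMarkovChain q X Y fun ω => f (Z ω) := by
  cases nonempty_fintype C
  intro x y d
  have hXY : law q (fun ω => (X ω, Y ω, f (Z ω))) (x, y, d) =
      prob (fun z => law q (fun ω => (X ω, Y ω, Z ω)) (x, y, z)) fun z => f z = d := by
    have hassoc (z : C) : law q (fun ω => (X ω, Y ω, Z ω)) (x, y, z) =
        law q (fun ω => ((X ω, Y ω), Z ω)) ((x, y), z) :=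
      law_congr q fun ω => by simp [and_assoc]
    simp only [hassoc]
    rw [prob_law_pair_left]
    exact prob_congr q fun ω => by simp [and_assoc]
  have hY : law q (fun ω => (Y ω, f (Z ω))) (y, d) =
      prob (fun z => law q (fun ω => (Y ω, Z ω)) (y, z)) fun z => f z = d := by
    rw [prob_law_pair_left]
    exact prob_congr q fun ω => by simp
  rw [hXY, hY, prob, prob, Finset.sum_mul, Finset.mul_sum]
  refine Finset.sum_congr rfl fun z _ => ?_
  split_ifs
  · exact h x y z
  · simp

end Law

section CondLaw

variable {Ω A B C : Type*} [Fintype Ω]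

/-- The conditional probability `P(X = x | Y = y)`. It is the zero function of `x` when
`P(Y = y) = 0`. -/
noncomputable def condLaw (q : Ω → ℝ) (X : Ω → A) (Y : Ω → B) (y : B) (x : A) : ℝ :=
  law q (fun ω => (X ω, Y ω)) (x, y) / law q Y y

theorem condLaw_nonneg {q : Ω → ℝ} (hq : ∀ ω, 0 ≤ q ω) (X : Ω → A) (Y : Ω → B) (y : B) (x : A) :
    0 ≤ condLaw q X Y y x :=
  div_nonneg (law_nonneg hq _ _) (law_nonneg hq _ _)

theorem condLaw_pos {q : Ω → ℝ} (hq : ∀ ω, 0 ≤ q ω) (X : Ω → A) (Y : Ω → B) {ω : Ω}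
    (h : 0 < q ω) : 0 < condLaw q X Y (Y ω) (X ω) :=
  div_pos (law_pos hq (fun ω => (X ω, Y ω)) h) (law_pos hq Y h)

theorem sum_condLaw [Fintype A] (q : Ω → ℝ) (X : Ω → A) (Y : Ω → B) (y : B) :
    ∑ x, condLaw q X Y y x = law q Y y / law q Y y := by
  simp only [condLaw]
  rw [← Finset.sum_div, sum_law_pair_right]

theorem sum_condLaw_le_one [Fintype A] (q : Ω → ℝ) (X : Ω → A) (Y : Ω → B) (y : B) :
    ∑ x, condLaw q X Y y x ≤ 1 :=
  (sum_condLaw q X Y y).trans_le (div_self_le_one _)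

theorem condLaw_mem_stdSimplex [Fintype A] {q : Ω → ℝ} (hq : ∀ ω, 0 ≤ q ω) (X : Ω → A)
    (Y : Ω → B) {y : B} (hy : law q Y y ≠ 0) : condLaw q X Y y ∈ stdSimplex ℝ A :=
  ⟨condLaw_nonneg hq X Y y, by rw [sum_condLaw, div_self hy]⟩

theorem law_mul_condLaw {q : Ω → ℝ} (hq : ∀ ω, 0 ≤ q ω) (X : Ω → A) (Y : Ω → B) (y : B) (x : A) :
    law q Y y * condLaw q X Y y x = law q (fun ω => (X ω, Y ω)) (x, y) :=
  mul_div_cancel_of_imp' fun hy => le_antisymm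
    (hy ▸ law_le_law hq fun _ h => (Prod.mk.inj h).2) (law_nonneg hq _ _)

theorem sum_mul_prob_condLaw [Fintype A] [Finite B] {q : Ω → ℝ} (hq : ∀ ω, 0 ≤ q ω)
    (X : Ω → A) (Y : Ω → B) (E : B → A → Prop) :
    ∑ ω, q ω * prob (condLaw q X Y (Y ω)) (E (Y ω)) = prob q fun ω => E (Y ω) (X ω) := by
  classical
  cases nonempty_fintype B
  rw [← sum_law_mul q Y fun y => prob (condLaw q X Y y) (E y)]
  calc ∑ y, law q Y y * prob (condLaw q X Y y) (E y)
      = ∑ y, ∑ x, law q (fun ω => (X ω, Y ω)) (x, y) * if E y x then 1 else 0 := by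
        simp only [prob_eq_sum_mul, Finset.mul_sum, ← mul_assoc, law_mul_condLaw hq]
    _ = prob (law q fun ω => (X ω, Y ω)) fun a => E a.2 a.1 := by
        rw [prob_eq_sum_mul, Fintype.sum_prod_type_right]
    _ = prob q fun ω => E (Y ω) (X ω) := prob_law q (fun ω => (X ω, Y ω)) fun a => E a.2 a.1

theorem IsMarkovChain.condLaw_eq {q : Ω → ℝ} {X : Ω → A} {Y : Ω → B} {Z : Ω → C}
    (h : IsMarkovChain q X Y Z) (hq : ∀ ω, 0 ≤ q ω) {y : B} {z : C}
    (hyz : law q (fun ω => (Y ω, Z ω)) (y, z) ≠ 0) (x : A) :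
    condLaw q X (fun ω => (Y ω, Z ω)) (y, z) x = condLaw q X Y y x := by
  have hy : law q Y y ≠ 0 := fun hy =>
    hyz (le_antisymm (hy ▸ law_le_law hq fun _ h => (Prod.mk.inj h).1) (law_nonneg hq _ _))
  rw [condLaw, condLaw, div_eq_div_iff hyz hy, h]

end CondLaw

section Entropy

variable {Ω A B C : Type*} [Fintype Ω]

/-- The entropy of `X` in bits, written as the expectation of `-log₂ p(X)`. -/
noncomputable def entropy (q : Ω → ℝ) (X : Ω → A) : ℝ :=
  ∑ ω, q ω * -Real.logb 2 (law q X (X ω))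

theorem entropy_congr (q : Ω → ℝ) {X : Ω → A} {Y : Ω → B}
    (h : ∀ ω ω', X ω = X ω' ↔ Y ω = Y ω') : entropy q X = entropy q Y :=
  Finset.sum_congr rfl fun ω _ => by rw [law_congr q fun ω' => h ω' ω]

theorem entropy_law [Fintype A] (q : Ω → ℝ) (X : Ω → A) (f : A → B) :
    entropy (law q X) f = entropy q fun ω => f (X ω) := by
  unfold entropy
  rw [sum_law_mul q X fun a => -Real.logb 2 (law (law q X) f (f a)), law_law]

theorem entropy_mono {q : Ω → ℝ} (hq : ∀ ω, 0 ≤ q ω) {X : Ω → A} {Y : Ω → B}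
    (h : ∀ ω ω', Y ω = Y ω' → X ω = X ω') : entropy q X ≤ entropy q Y :=
  sum_mul_le_sum_mul_of_pos hq fun ω hω => neg_le_neg <|
    Real.logb_le_logb_of_le one_lt_two (law_pos hq Y hω) (law_le_law hq fun ω' => h ω' ω)

theorem entropy_const {q : Ω → ℝ} (hq : q ∈ stdSimplex ℝ Ω) (a : A) :
    entropy q (fun _ => a) = 0 := by
  simp [entropy, law, hq.2]

theorem condEntropy_eq_sum [Fintype A] [Fintype B] (q : Ω → ℝ) (X : Ω → A) (Y : Ω → B) :
    condEntropy q X Y = ∑ ω, q ω * -Real.logb 2 (condLaw q X Y (Y ω) (X ω)) := by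
  rw [← sum_law_mul q (fun ω => (X ω, Y ω)) fun a => -Real.logb 2 (condLaw q X Y a.2 a.1)]
  simp only [condEntropy, condLaw, Fintype.sum_prod_type, mul_neg, Finset.sum_neg_distrib]

theorem mutualInfo_eq_sum [Fintype A] [Fintype B] (q : Ω → ℝ) (X : Ω → A) (U : Ω → B) :
    mutualInfo q X U =
      ∑ ω, q ω * Real.logb 2 (condLaw q U X (X ω) (U ω) / law q U (U ω)) := by
  rw [← sum_law_mul q (fun ω => (X ω, U ω)) fun a =>
    Real.logb 2 (condLaw q U X a.1 a.2 / law q U a.2)]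
  simp only [mutualInfo, condLaw, Fintype.sum_prod_type, div_div, law_swap q U X]

theorem condMutualInfo_eq_sum [Fintype A] [Fintype B] [Fintype C] {q : Ω → ℝ}
    (hq : ∀ ω, 0 ≤ q ω) (X : Ω → A) (V : Ω → B) (U : Ω → C) :
    condMutualInfo q X V U = ∑ ω, q ω * Real.logb 2
      (condLaw q V (fun ω => (X ω, U ω)) (X ω, U ω) (V ω) / condLaw q V U (U ω) (V ω)) := by
  have hexp := sum_law_mul q (fun ω => (X ω, V ω, U ω)) fun a =>
    Real.logb 2 ((law q (fun ω => (X ω, V ω, U ω)) a / law q U a.2.2) /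
      ((law q (fun ω => (X ω, U ω)) (a.1, a.2.2) / law q U a.2.2) *
        (law q (fun ω => (V ω, U ω)) a.2 / law q U a.2.2)))
  simp only [Fintype.sum_prod_type] at hexp
  rw [condMutualInfo, hexp]
  refine sum_mul_eq_sum_mul_of_pos hq fun ω hω => ?_
  have hU := (law_pos hq U hω).ne'
  have hXU := (law_pos hq (fun ω => (X ω, U ω)) hω).ne'
  have hVU := (law_pos hq (fun ω => (V ω, U ω)) hω).ne'
  rw [condLaw, condLaw, law_congr q (X := fun ω => (V ω, X ω, U ω))
    (Y := fun ω => (X ω, V ω, U ω)) (b := (X ω, V ω, U ω)) fun ω' => by simp [and_left_comm]]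
  congr 1
  field_simp

theorem logb_condLaw {q : Ω → ℝ} (hq : ∀ ω, 0 ≤ q ω) (X : Ω → A) (Y : Ω → B) {ω : Ω}
    (hω : 0 < q ω) :
    Real.logb 2 (condLaw q X Y (Y ω) (X ω)) =
      Real.logb 2 (law q (fun ω => (X ω, Y ω)) (X ω, Y ω)) - Real.logb 2 (law q Y (Y ω)) :=
  Real.logb_div (law_pos hq (fun ω => (X ω, Y ω)) hω).ne' (law_pos hq Y hω).ne'

theorem condEntropy_eq [Fintype A] [Fintype B] {q : Ω → ℝ} (hq : ∀ ω, 0 ≤ q ω) (X : Ω → A)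
    (Y : Ω → B) : condEntropy q X Y = entropy q (fun ω => (X ω, Y ω)) - entropy q Y := by
  rw [condEntropy_eq_sum, entropy, entropy, ← Finset.sum_sub_distrib]
  simp only [← mul_sub]
  exact sum_mul_eq_sum_mul_of_pos hq fun ω hω => by rw [logb_condLaw hq X Y hω]; ring

theorem mutualInfo_eq [Fintype A] [Fintype B] {q : Ω → ℝ} (hq : ∀ ω, 0 ≤ q ω) (X : Ω → A)
    (U : Ω → B) :
    mutualInfo q X U = entropy q X + entropy q U - entropy q (fun ω => (X ω, U ω)) := by
  rw [mutualInfo_eq_sum, entropy_congr q (X := fun ω => (X ω, U ω)) (Y := fun ω => (U ω, X ω))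
    (by simp [and_comm]), entropy, entropy, entropy, ← Finset.sum_add_distrib,
    ← Finset.sum_sub_distrib]
  simp only [← mul_sub, ← mul_add]
  refine sum_mul_eq_sum_mul_of_pos hq fun ω hω => ?_
  rw [Real.logb_div (condLaw_pos hq U X hω).ne' (law_pos hq U hω).ne', logb_condLaw hq U X hω]
  ring

theorem condMutualInfo_eq [Fintype A] [Fintype B] [Fintype C] {q : Ω → ℝ} (hq : ∀ ω, 0 ≤ q ω)
    (X : Ω → A) (V : Ω → B) (U : Ω → C) :
    condMutualInfo q X V U = entropy q (fun ω => (X ω, U ω)) + entropy q (fun ω => (V ω, U ω))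
      - entropy q (fun ω => (X ω, V ω, U ω)) - entropy q U := by
  rw [condMutualInfo_eq_sum hq, entropy_congr q (X := fun ω => (X ω, V ω, U ω))
    (Y := fun ω => (V ω, X ω, U ω)) (by simp [and_left_comm]), entropy, entropy, entropy, entropy,
    ← Finset.sum_add_distrib, ← Finset.sum_sub_distrib, ← Finset.sum_sub_distrib]
  simp only [← mul_sub, ← mul_add]
  refine sum_mul_eq_sum_mul_of_pos hq fun ω hω => ?_
  rw [Real.logb_div (condLaw_pos hq V (fun ω => (X ω, U ω)) hω).ne' (condLaw_pos hq V U hω).ne',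
    logb_condLaw hq V (fun ω => (X ω, U ω)) hω, logb_condLaw hq V U hω]
  ring

theorem entropy_le_sum_mul_neg_logb [Fintype A] {q : Ω → ℝ} (hq : q ∈ stdSimplex ℝ Ω) (X : Ω → A)
    {r : A → ℝ} (hr : ∀ a, 0 ≤ r a) (hr1 : ∑ a, r a ≤ 1) (hpos : ∀ ω, 0 < q ω → 0 < r (X ω)) :
    entropy q X ≤ ∑ ω, q ω * -Real.logb 2 (r (X ω)) := by
  have hlog : 0 < Real.log 2 := Real.log_pos one_lt_two
  have hratio : ∑ ω, q ω * (r (X ω) / law q X (X ω)) ≤ 1 := by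
    rw [← sum_law_mul q X fun a => r a / law q X a]
    refine (Finset.sum_le_sum fun a _ => ?_).trans hr1
    exact mul_div_left_comm (law q X a) (r a) _ ▸ mul_le_of_le_one_right (hr a) (div_self_le_one _)
  rw [← sub_nonpos, entropy, ← Finset.sum_sub_distrib]
  simp only [← mul_sub]
  calc ∑ ω, q ω * (-Real.logb 2 (law q X (X ω)) - -Real.logb 2 (r (X ω)))
      = ∑ ω, q ω * Real.logb 2 (r (X ω) / law q X (X ω)) :=
        sum_mul_eq_sum_mul_of_pos hq.1 fun ω hω => by
          rw [Real.logb_div (hpos ω hω).ne' (law_pos hq.1 X hω).ne']; ring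
    _ ≤ ∑ ω, q ω * ((r (X ω) / law q X (X ω) - 1) / Real.log 2) :=
        sum_mul_le_sum_mul_of_pos hq.1 fun ω hω => div_le_div_of_nonneg_right
          (Real.log_le_sub_one_of_pos (div_pos (hpos ω hω) (law_pos hq.1 X hω))) hlog.le
    _ = (∑ ω, q ω * (r (X ω) / law q X (X ω)) - ∑ ω, q ω) / Real.log 2 := by
        rw [← Finset.sum_sub_distrib, Finset.sum_div]
        exact Finset.sum_congr rfl fun ω _ => by ring
    _ ≤ 0 := div_nonpos_of_nonpos_of_nonneg (by linarith [hq.2]) hlog.le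

theorem nonempty_of_mem_stdSimplex {q : Ω → ℝ} (hq : q ∈ stdSimplex ℝ Ω) : Nonempty Ω := by
  by_contra hΩ
  rw [not_nonempty_iff] at hΩ
  simpa using hq.2

theorem entropy_le_logb_card [Fintype A] {q : Ω → ℝ} (hq : q ∈ stdSimplex ℝ Ω) (X : Ω → A) :
    entropy q X ≤ Real.logb 2 (Fintype.card A) := by
  have : Nonempty A := (nonempty_of_mem_stdSimplex hq).map X
  have hcard : (0 : ℝ) < Fintype.card A := mod_cast Fintype.card_pos
  have h := entropy_le_sum_mul_neg_logb hq X (r := fun _ => (Fintype.card A : ℝ)⁻¹)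
    (fun _ => inv_nonneg.mpr hcard.le) (by simp) fun _ _ => inv_pos.mpr hcard
  simpa only [Real.logb_inv, neg_neg, ← Finset.sum_mul, hq.2, one_mul] using h

theorem condMutualInfo_nonneg [Fintype A] [Fintype B] [Fintype C] {q : Ω → ℝ}
    (hq : q ∈ stdSimplex ℝ Ω) (X : Ω → A) (V : Ω → B) (U : Ω → C) :
    0 ≤ condMutualInfo q X V U := by
  set r : A × B × C → ℝ := fun a =>
    law q (fun ω => (V ω, U ω)) a.2 * condLaw q X U a.2.2 a.1
  have hr (a) : 0 ≤ r a := mul_nonneg (law_nonneg hq.1 _ _) (condLaw_nonneg hq.1 _ _ _ _)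
  have hr1 : ∑ a, r a ≤ 1 := by
    calc ∑ a, r a = ∑ b, law q (fun ω => (V ω, U ω)) b * ∑ x, condLaw q X U b.2 x := by
          rw [Fintype.sum_prod_type_right]
          simp only [r, Finset.mul_sum]
      _ ≤ ∑ b, law q (fun ω => (V ω, U ω)) b := Finset.sum_le_sum fun b _ =>
          mul_le_of_le_one_right (law_nonneg hq.1 _ _) (sum_condLaw_le_one q X U _)
      _ = 1 := by rw [sum_law, hq.2]
  have hgibbs := entropy_le_sum_mul_neg_logb hq (fun ω => (X ω, V ω, U ω)) hr hr1 fun ω hω =>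
    mul_pos (law_pos hq.1 (fun ω => (V ω, U ω)) hω) (condLaw_pos hq.1 X U hω)
  have hcross : ∑ ω, q ω * -Real.logb 2 (r (X ω, V ω, U ω)) =
      entropy q (fun ω => (V ω, U ω)) + condEntropy q X U := by
    rw [entropy, condEntropy_eq_sum, ← Finset.sum_add_distrib]
    simp only [← mul_add]
    refine sum_mul_eq_sum_mul_of_pos hq.1 fun ω hω => ?_
    rw [Real.logb_mul (law_pos hq.1 (fun ω => (V ω, U ω)) hω).ne' (condLaw_pos hq.1 X U hω).ne']
    ring
  rw [condMutualInfo_eq hq.1]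
  linarith [condEntropy_eq hq.1 X U]

theorem entropy_submodular {q : Ω → ℝ} (hq : q ∈ stdSimplex ℝ Ω) (X : Ω → A) (Y : Ω → B)
    (Z : Ω → C) :
    entropy q (fun ω => (X ω, Y ω, Z ω)) + entropy q Z ≤
      entropy q (fun ω => (X ω, Z ω)) + entropy q (fun ω => (Y ω, Z ω)) := by
  classical
  have h := condMutualInfo_nonneg hq (Set.rangeFactorization X) (Set.rangeFactorization Y)
    (Set.rangeFactorization Z)
  rw [condMutualInfo_eq hq.1] at h
  have hXYZ := entropy_congr q (X := fun ω => (X ω, Y ω, Z ω)) (Y := fun ω =>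
    (Set.rangeFactorization X ω, Set.rangeFactorization Y ω, Set.rangeFactorization Z ω))
    (by simp [Subtype.ext_iff])
  have hXZ := entropy_congr q (X := fun ω => (X ω, Z ω)) (Y := fun ω =>
    (Set.rangeFactorization X ω, Set.rangeFactorization Z ω)) (by simp [Subtype.ext_iff])
  have hYZ := entropy_congr q (X := fun ω => (Y ω, Z ω)) (Y := fun ω =>
    (Set.rangeFactorization Y ω, Set.rangeFactorization Z ω)) (by simp [Subtype.ext_iff])
  have hZ := entropy_congr q (X := Z) (Y := Set.rangeFactorization Z) (by simp [Subtype.ext_iff])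
  linarith

theorem entropy_pair_le {q : Ω → ℝ} (hq : q ∈ stdSimplex ℝ Ω) (X : Ω → A) (Y : Ω → B) :
    entropy q (fun ω => (X ω, Y ω)) ≤ entropy q X + entropy q Y := by
  have h := entropy_submodular hq X Y fun _ => ()
  rwa [entropy_const hq, add_zero,
    entropy_congr q (X := fun ω => (X ω, Y ω, ())) (Y := fun ω => (X ω, Y ω)) (by simp),
    entropy_congr q (X := fun ω => (X ω, ())) (Y := X) (by simp),
    entropy_congr q (X := fun ω => (Y ω, ())) (Y := Y) (by simp)] at h

theorem condEntropy_nonneg [Fintype A] [Fintype B] {q : Ω → ℝ} (hq : ∀ ω, 0 ≤ q ω)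
    (X : Ω → A) (Y : Ω → B) : 0 ≤ condEntropy q X Y := by
  rw [condEntropy_eq hq, sub_nonneg]
  exact entropy_mono hq fun ω ω' h => (Prod.mk.inj h).2

theorem mutualInfo_nonneg [Fintype A] [Fintype B] {q : Ω → ℝ} (hq : q ∈ stdSimplex ℝ Ω)
    (X : Ω → A) (U : Ω → B) : 0 ≤ mutualInfo q X U := by
  rw [mutualInfo_eq hq.1, sub_nonneg]
  exact entropy_pair_le hq X U

theorem entropy_pair_le_entropy_add_prob_ne_mul [Fintype A] {q : Ω → ℝ}
    (hq : q ∈ stdSimplex ℝ Ω) (X Y : Ω → A) :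
    entropy q (fun ω => (X ω, Y ω)) ≤
      entropy q Y + (1 + prob q (fun ω => X ω ≠ Y ω) * Real.logb 2 (Fintype.card A)) := by
  classical
  have : Nonempty A := (nonempty_of_mem_stdSimplex hq).map X
  have hcard : (0 : ℝ) < Fintype.card A := mod_cast Fintype.card_pos
  -- Fano's inequality: guess `X = Y` with probability `1/2`, and a uniform value of `X` otherwise.
  set r : A → A → ℝ := fun a b => (if a = b then 1 / 2 else 0) + 1 / (2 * Fintype.card A)
  have hr (a b) : 0 < r a b := add_pos_of_nonneg_of_pos (by positivity) (by positivity)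
  have hr1 (b) : ∑ a, r a b = 1 := by
    simp only [r, Finset.sum_add_distrib, Finset.sum_ite_eq', Finset.mem_univ, if_true,
      Finset.sum_const, Finset.card_univ, nsmul_eq_mul]
    field_simp
    norm_num
  have hlog (a b) : -Real.logb 2 (r a b) ≤
      1 + (if a ≠ b then 1 else 0) * Real.logb 2 (Fintype.card A) := by
    rw [← Real.logb_inv]
    by_cases hab : a = b
    · calc Real.logb 2 (r a b)⁻¹ ≤ Real.logb 2 2 := by
            refine Real.logb_le_logb_of_le one_lt_two (by simpa using hr a b) ?_
            refine inv_le_of_inv_le₀ two_pos ?_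
            simp [r, hab]
        _ = _ := by simp [hab]
    · simp [r, hab, Real.logb_mul, hcard.ne']
  have hgibbs := entropy_le_sum_mul_neg_logb hq (fun ω => (X ω, Y ω))
    (r := fun a => law q Y a.2 * r a.1 a.2) (fun a => mul_nonneg (law_nonneg hq.1 _ _) (hr _ _).le)
    (by simp only [Fintype.sum_prod_type_right, ← Finset.mul_sum, hr1, mul_one, sum_law, hq.2,
      le_refl]) fun ω hω => mul_pos (law_pos hq.1 Y hω) (hr _ _)
  calc entropy q (fun ω => (X ω, Y ω))
      ≤ ∑ ω, q ω * (-Real.logb 2 (law q Y (Y ω)) +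
          (1 + (if X ω ≠ Y ω then 1 else 0) * Real.logb 2 (Fintype.card A))) := by
        refine hgibbs.trans (sum_mul_le_sum_mul_of_pos hq.1 fun ω hω => ?_)
        rw [Real.logb_mul (law_pos hq.1 Y hω).ne' (hr _ _).ne']
        linarith [hlog (X ω) (Y ω)]
    _ = _ := by
        rw [prob_eq_sum_mul, Finset.sum_mul]
        simp only [mul_add, Finset.sum_add_distrib, mul_one, hq.2, entropy, mul_assoc]

end Entropy

section Product

variable {Ω A : Type*}

/-- The mass function of `n` i.i.d. copies. -/
def iidMass (n : ℕ) (q : Ω → ℝ) (x : Fin n → Ω) : ℝ := ∏ i, q (x i)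

theorem pos_of_iidMass_pos {n : ℕ} {q : Ω → ℝ} (hq : ∀ ω, 0 ≤ q ω) {x : Fin n → Ω}
    (h : 0 < iidMass n q x) (i : Fin n) : 0 < q (x i) :=
  (hq _).lt_of_ne' fun h0 => h.ne' (Finset.prod_eq_zero (Finset.mem_univ i) h0)

variable [Fintype Ω]

theorem sum_iidMass_mul_prod (n : ℕ) (q : Ω → ℝ) (f : Fin n → Ω → ℝ) :
    ∑ x, iidMass n q x * ∏ i, f i (x i) = ∏ i, ∑ ω, q ω * f i ω := by
  classical
  simp only [iidMass, ← Finset.prod_mul_distrib]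
  rw [Finset.prod_univ_sum, Fintype.piFinset_univ]

theorem iidMass_mem_stdSimplex (n : ℕ) {q : Ω → ℝ} (hq : q ∈ stdSimplex ℝ Ω) :
    iidMass n q ∈ stdSimplex ℝ (Fin n → Ω) :=
  ⟨fun _ => Finset.prod_nonneg fun _ _ => hq.1 _, by
    simpa [hq.2] using sum_iidMass_mul_prod n q fun _ _ => 1⟩

theorem prob_iidMass_forall (n : ℕ) (q : Ω → ℝ) (E : Fin n → Ω → Prop) :
    prob (iidMass n q) (fun x => ∀ i, E i (x i)) = ∏ i, prob q (E i) := by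
  classical
  simp only [prob_eq_sum_mul]
  rw [← sum_iidMass_mul_prod]
  simp [Finset.prod_ite_zero]

theorem law_iidMass (n : ℕ) (q : Ω → ℝ) (W : Fin n → Ω → A) (c : Fin n → A) :
    law (iidMass n q) (fun x i => W i (x i)) c = ∏ i, law q (W i) (c i) :=
  (prob_congr _ fun _ => funext_iff).trans (prob_iidMass_forall n q fun i ω => W i ω = c i)

theorem sum_iidMass_mul_coord (n : ℕ) {q : Ω → ℝ} (hq : q ∈ stdSimplex ℝ Ω) (i : Fin n)
    (f : Ω → ℝ) : ∑ x, iidMass n q x * f (x i) = ∑ ω, q ω * f ω := by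
  classical
  calc ∑ x, iidMass n q x * f (x i)
      = ∑ x, iidMass n q x * ∏ j, if j = i then f (x j) else 1 := by simp
    _ = ∏ j, ∑ ω, q ω * if j = i then f ω else 1 :=
        sum_iidMass_mul_prod n q fun j ω => if j = i then f ω else 1
    _ = ∑ ω, q ω * f ω := by
        rw [Finset.prod_eq_single i (fun j _ hj => by simp [hj, hq.2]) (by simp)]
        simp

theorem entropy_iidMass (n : ℕ) {q : Ω → ℝ} (hq : q ∈ stdSimplex ℝ Ω) (W : Fin n → Ω → A) :
    entropy (iidMass n q) (fun x i => W i (x i)) = ∑ i, entropy q (W i) := by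
  calc entropy (iidMass n q) (fun x i => W i (x i))
      = ∑ x, iidMass n q x * ∑ i, -Real.logb 2 (law q (W i) (W i (x i))) := by
        refine sum_mul_eq_sum_mul_of_pos (iidMass_mem_stdSimplex n hq).1 fun x hx => ?_
        rw [law_iidMass, Real.logb_prod _ _ fun i _ =>
          (law_pos hq.1 (W i) (pos_of_iidMass_pos hq.1 hx i)).ne', Finset.sum_neg_distrib]
    _ = ∑ i, ∑ x, iidMass n q x * -Real.logb 2 (law q (W i) (W i (x i))) := by
        simp only [Finset.mul_sum]
        rw [Finset.sum_comm]
    _ = ∑ i, entropy q (W i) := Finset.sum_congr rfl fun i _ =>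
        sum_iidMass_mul_coord n hq i fun ω => -Real.logb 2 (law q (W i) (W i ω))

end Product

section RandomCoding

theorem exists_le_of_sum_mul_le {ι : Type*} [Fintype ι] {w f : ι → ℝ} {b : ℝ}
    (hw : w ∈ stdSimplex ℝ ι) (h : ∑ i, w i * f i ≤ b) : ∃ i, f i ≤ b := by
  by_contra! hlt
  exact ((convex_Ioi b).sum_mem (fun i _ => hw.1 i) hw.2 fun i _ => hlt i).not_ge h

theorem one_sub_pow_le {g a Γ : ℝ} (M : ℕ) (hΓ : 0 < Γ) (ha : 0 ≤ a) (ha1 : a ≤ 1)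
    (hag : a ≤ Γ * g) (hg : g ≤ 1) : (1 - g) ^ M ≤ 1 - a + Real.exp (-(M / Γ)) := by
  have hexp : 1 - g ≤ Real.exp (-(a / Γ)) := by
    linarith [Real.add_one_le_exp (-(a / Γ)), (div_le_iff₀' hΓ).mpr hag]
  calc (1 - g) ^ M ≤ Real.exp (-(a / Γ)) ^ M := pow_le_pow_left₀ (by linarith) hexp M
    _ = Real.exp ((1 - a) * 0 + a * (-(M / Γ))) := by
        rw [← Real.exp_nat_mul]; congr 1; ring
    _ ≤ (1 - a) * Real.exp 0 + a * Real.exp (-(M / Γ)) :=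
        convexOn_exp.2 (Set.mem_univ _) (Set.mem_univ _) (sub_nonneg.mpr ha1) ha (by ring)
    _ ≤ 1 - a + Real.exp (-(M / Γ)) := by
        rw [Real.exp_zero, mul_one]
        gcongr
        exact mul_le_of_le_one_left (Real.exp_nonneg _) ha1

variable {X U S : Type*} [Fintype X]

theorem exists_codebook [Fintype U] [Nonempty U] {w : X → ℝ} (hw : ∀ x, 0 ≤ w x)
    {r : U → ℝ} (hr : ∀ x, w x ≠ 0 → r ∈ stdSimplex ℝ U)
    {W : X → U → ℝ} (hW : ∀ x, w x ≠ 0 → W x ∈ stdSimplex ℝ U)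
    {G : X → U → Prop} {Γ : ℝ} (hΓ : 0 < Γ)
    (hG : ∀ x u, w x ≠ 0 → G x u → W x u ≤ Γ * r u) (M : ℕ) :
    ∃ c : Fin M → U, prob w (fun x => ∀ m, ¬ G x (c m)) ≤
      ∑ x, w x * (prob (W x) (fun u => ¬ G x u) + Real.exp (-(M / Γ))) := by
  classical
  by_cases hw0 : ∀ x, w x = 0
  · exact ⟨fun _ => Classical.arbitrary U, by simp [prob, hw0]⟩
  obtain ⟨x₀, hx₀⟩ := not_forall.mp hw0
  have hr := hr x₀ hx₀
  -- Draw the codewords independently from `r`.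
  refine exists_le_of_sum_mul_le (iidMass_mem_stdSimplex M hr) ?_
  rw [sum_mul_prob_comm]
  refine sum_mul_le_sum_mul_of_pos hw fun x hx => ?_
  have hWx := hW x hx.ne'
  have hcover : prob (W x) (G x) ≤ Γ * prob r (G x) := by
    rw [prob, prob, Finset.mul_sum]
    refine Finset.sum_le_sum fun u _ => ?_
    split_ifs with hxu
    · exact hG x u hx.ne' hxu
    · simp
  have hW1 : prob (W x) (fun u => ¬ G x u) = 1 - prob (W x) (G x) := by
    linarith [prob_add_prob_not (W x) (G x), hWx.2]
  have hr1 : prob r (fun u => ¬ G x u) = 1 - prob r (G x) := by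
    linarith [prob_add_prob_not r (G x), hr.2]
  have hW0 := prob_nonneg hWx.1 fun u => ¬ G x u
  have hr0 := prob_nonneg hr.1 fun u => ¬ G x u
  rw [prob_iidMass_forall M r fun _ u => ¬ G x u, Finset.prod_const, Finset.card_univ,
    Fintype.card_fin, hr1, hW1]
  exact one_sub_pow_le M hΓ (prob_nonneg hWx.1 _) (by linarith) hcover (by linarith)

theorem exists_covering_code [Fintype U] [Nonempty U] [Finite S] {w : X → ℝ}
    (hw : ∀ x, 0 ≤ w x) (s : X → S) {r : S → U → ℝ}
    (hr : ∀ x, w x ≠ 0 → r (s x) ∈ stdSimplex ℝ U)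
    {W : X → U → ℝ} (hW : ∀ x, w x ≠ 0 → W x ∈ stdSimplex ℝ U)
    {G : X → U → Prop} {Γ : ℝ} (hΓ : 0 < Γ)
    (hG : ∀ x u, w x ≠ 0 → G x u → W x u ≤ Γ * r (s x) u) {M : ℕ} (hM : 0 < M) :
    ∃ (c : S → Fin M → U) (φ : X → Fin M), prob w (fun x => ¬ G x (c (s x) (φ x))) ≤
      ∑ x, w x * (prob (W x) (fun u => ¬ G x u) + Real.exp (-(M / Γ))) := by
  classical
  cases nonempty_fintype S
  have : NeZero M := ⟨hM.ne'⟩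
  have hsplit (f : X → ℝ) : ∑ t, ∑ x, (if s x = t then w x else 0) * f x = ∑ x, w x * f x := by
    rw [Finset.sum_comm]
    simp
  have hbook (t : S) := exists_codebook (w := fun x => if s x = t then w x else 0)
    (fun x => by split_ifs <;> simp [hw x]) (r := r t) (W := W) (G := G)
    (fun x hx => by
      obtain ⟨rfl, hwx⟩ := ite_ne_right_iff.mp hx
      exact hr x hwx)
    (fun x hx => hW x (ite_ne_right_iff.mp hx).2) hΓ
    (fun x u hx => by
      obtain ⟨rfl, hwx⟩ := ite_ne_right_iff.mp hx
      exact hG x u hwx) M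
  choose c hc using hbook
  refine ⟨c, fun x => Classical.epsilon fun m => G x (c (s x) m), ?_⟩
  calc prob w (fun x => ¬ G x (c (s x) (Classical.epsilon fun m => G x (c (s x) m))))
      ≤ prob w fun x => ∀ m, ¬ G x (c (s x) m) :=
        prob_mono hw fun x _ hx m hm => hx <|
          Classical.epsilon_spec (p := fun m => G x (c (s x) m)) ⟨m, hm⟩
    _ = ∑ t, prob (fun x => if s x = t then w x else 0) fun x => ∀ m, ¬ G x (c t m) := by
        simp only [prob_eq_sum_mul]
        rw [← hsplit]
        refine Finset.sum_congr rfl fun t _ => Finset.sum_congr rfl fun x _ => ?_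
        by_cases h : s x = t
        · rw [h]
        · simp [h]
    _ ≤ _ := (Finset.sum_le_sum fun t _ => hc t).trans_eq (hsplit _)

theorem prob_uniform_collision {L : ℕ} [NeZero L] [DecidableEq X] {x x' : X} (h : x ≠ x') :
    prob (fun _ : X → Fin L => (Fintype.card (X → Fin L) : ℝ)⁻¹) (fun b => b x = b x') =
      (L : ℝ)⁻¹ := by
  set r : (X → Fin L) → ℝ := fun _ => (Fintype.card (X → Fin L) : ℝ)⁻¹
  -- Shifting the bin of `x` by `t` permutes the binnings.
  have hshift (t : Fin L) : prob r (fun b => b x + t = b x') = prob r fun b => b x = b x' := by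
    let e : (X → Fin L) ≃ (X → Fin L) :=
      { toFun := fun b => Function.update b x (b x + t)
        invFun := fun b => Function.update b x (b x - t)
        left_inv := fun b => by simp
        right_inv := fun b => by simp }
    exact Fintype.sum_equiv e _ _ fun b => by simp [e, h.symm, r]
  have hsum : ∑ t : Fin L, prob r (fun b => b x + t = b x') = 1 := by
    simp only [prob]
    rw [Finset.sum_comm]
    simp [← eq_sub_iff_add_eq', r]
  simp only [hshift, Finset.sum_const, Finset.card_univ, Fintype.card_fin, nsmul_eq_mul] at hsum
  exact eq_inv_of_mul_eq_one_right hsum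

theorem exists_binning_code {Ω : Type*} [Fintype Ω] {q : Ω → ℝ} (hq : q ∈ stdSimplex ℝ Ω)
    (ξ : Ω → X) (σ : Ω → S) {T : S → X → Prop} {N : ℝ} (hT : ∀ s, prob (fun _ => 1) (T s) ≤ N)
    {L : ℕ} (hL : 0 < L) :
    ∃ (b : X → Fin L) (d : S → Fin L → X),
      prob q (fun ω => T (σ ω) (ξ ω) ∧ d (σ ω) (b (ξ ω)) ≠ ξ ω) ≤ N / L := by
  classical
  have : NeZero L := ⟨hL.ne'⟩
  have : Nonempty X := (nonempty_of_mem_stdSimplex hq).map ξ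
  have hr : (fun _ => (Fintype.card (X → Fin L) : ℝ)⁻¹) ∈ stdSimplex ℝ (X → Fin L) :=
    ⟨fun _ => by positivity, by simp⟩
  have hconfuse (s : S) (x : X) : prob (fun _ => (Fintype.card (X → Fin L) : ℝ)⁻¹)
      (fun b : X → Fin L => ∃ x', (x' ≠ x ∧ T s x') ∧ b x' = b x) ≤ N / L := by
    calc _ ≤ ∑ x', prob (fun _ => (Fintype.card (X → Fin L) : ℝ)⁻¹)
          (fun b : X → Fin L => (x' ≠ x ∧ T s x') ∧ b x' = b x) := prob_exists_le hr.1 _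
      _ ≤ ∑ x', if T s x' then (L : ℝ)⁻¹ else 0 := by
          refine Finset.sum_le_sum fun x' _ => ?_
          by_cases hx' : x' ≠ x ∧ T s x'
          · rw [if_pos hx'.2]
            exact (prob_mono hr.1 fun _ _ h => h.2).trans_eq (prob_uniform_collision hx'.1)
          · simp only [hx', false_and]
            simp only [prob, if_false, Finset.sum_const_zero]
            positivity
      _ = prob (fun _ => 1) (T s) * (L : ℝ)⁻¹ := by
          rw [prob, Finset.sum_mul]
          exact Finset.sum_congr rfl fun x' _ => by split_ifs <;> simp
      _ ≤ N / L := mul_le_mul_of_nonneg_right (hT s) (by positivity)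
  obtain ⟨b, hb⟩ : ∃ b : X → Fin L,
      prob q (fun ω => ∃ x', (x' ≠ ξ ω ∧ T (σ ω) x') ∧ b x' = b (ξ ω)) ≤ N / L := by
    refine exists_le_of_sum_mul_le hr ?_
    rw [sum_mul_prob_comm]
    calc _ ≤ ∑ ω, q ω * (N / L) :=
          sum_mul_le_sum_mul_of_pos hq.1 fun ω _ => hconfuse (σ ω) (ξ ω)
      _ = N / L := by rw [← Finset.sum_mul, hq.2, one_mul]
  refine ⟨b, fun s l => Classical.epsilon fun x => T s x ∧ b x = l, ?_⟩
  refine (prob_mono hq.1 fun ω _ ⟨hTω, hne⟩ => ?_).trans hb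
  have hd := Classical.epsilon_spec (p := fun x => T (σ ω) x ∧ b x = b (ξ ω)) ⟨ξ ω, hTω, rfl⟩
  exact ⟨_, ⟨hne, hd.1⟩, hd.2⟩

end RandomCoding

section OneShot

theorem mul_prob_lt_prob_condLaw_le {Ω A B : Type*} [Fintype Ω] [Fintype A] [Finite B] {q : Ω → ℝ}
    (hq : ∀ ω, 0 ≤ q ω) (X : Ω → A) (Y : Ω → B) (E : B → A → Prop) (δ : ℝ) :
    δ * prob q (fun ω => δ < prob (condLaw q X Y (Y ω)) (E (Y ω))) ≤
      prob q fun ω => E (Y ω) (X ω) :=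
  (mul_prob_lt_le_sum_mul hq (fun _ _ => prob_nonneg (condLaw_nonneg hq X Y _) _) δ).trans_eq
    (sum_mul_prob_condLaw hq X Y E)

theorem exp_neg_div_le {M Γ δ : ℝ} (hΓ : 0 < Γ) (hδ : 0 < δ) (h : Γ ≤ δ * M) :
    Real.exp (-(M / Γ)) ≤ δ := by
  have hinv : 1 / δ ≤ M / Γ := (div_le_div_iff₀ hδ hΓ).mpr (by linarith)
  rw [Real.exp_neg, inv_le_comm₀ (Real.exp_pos _) hδ, ← one_div]
  linarith [Real.add_one_le_exp (M / Γ)]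

theorem pos_of_le_mul_natCast {a δ : ℝ} {M : ℕ} (ha : 0 < a) (hδ : 0 < δ) (h : a ≤ δ * M) :
    0 < M :=
  Nat.cast_pos.mp (pos_of_mul_pos_right (ha.trans_le h) hδ.le)

variable {Ω A B C D : Type*} [Fintype Ω]

/-- The outcome `y` of `Y` belongs to the decoding list of `(u, v)`: its conditional probability
given `(U, V) = (u, v)` is at least `1 / N`, so that the list has at most `N` elements. -/
def InList (q : Ω → ℝ) (Y : Ω → B) (U : Ω → C) (V : Ω → D) (N : ℝ) (u : C) (v : D) (y : B) :
    Prop :=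
  1 ≤ N * condLaw q Y (fun ω => (U ω, V ω)) (u, v) y

theorem prob_inList_le [Fintype B] {q : Ω → ℝ} (hq : ∀ ω, 0 ≤ q ω) (Y : Ω → B) (U : Ω → C)
    (V : Ω → D) {N : ℝ} (hN : 0 ≤ N) (u : C) (v : D) :
    prob (fun _ => 1) (InList q Y U V N u v) ≤ N := by
  calc prob (fun _ => 1) (InList q Y U V N u v)
      ≤ ∑ y, N * condLaw q Y (fun ω => (U ω, V ω)) (u, v) y := by
        refine Finset.sum_le_sum fun y _ => ?_
        split_ifs with hy
        · exact hy
        · exact mul_nonneg hN (condLaw_nonneg hq _ _ _ _)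
    _ ≤ N := by
        rw [← Finset.mul_sum]
        exact mul_le_of_le_one_right hN (sum_condLaw_le_one q Y _ _)

/-- What a one-shot code needs for the sink that reconstructs `Y`: the Markov chain, and the
thresholds `Γ` for the conditional information density of `X` and `V` given `U` and `N` for the
inverse conditional probability of `Y` given `(U, V)`, exceeded with probability at most `δ ^ 3`.
-/
structure TypicalSink (q : Ω → ℝ) (X : Ω → A) (Y : Ω → B) (U : Ω → C) (V : Ω → D)
    (Γ N δ : ℝ) : Prop where
  isMarkovChain : IsMarkovChain q Y X fun ω => (U ω, V ω)
  prob_density_le : prob q (fun ω => Γ * condLaw q V U (U ω) (V ω) <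
    condLaw q V (fun ω => (X ω, U ω)) (X ω, U ω) (V ω)) ≤ δ ^ 3
  prob_list_le : prob q (fun ω =>
    N * condLaw q Y (fun ω => (U ω, V ω)) (U ω, V ω) (Y ω) < 1) ≤ δ ^ 3

section Sink

variable [Fintype B]

/-- The value `v` of `V` is a good refinement of the description `u` of `x`: the conditional
information density of `x` and `v` given `u` is at most `log Γ`, which bounds the number of
codewords needed to hit `v`, and given `X = x` the decoding list of `(u, v)` contains `Y` up to
probability `δ`. -/
def IsGoodRefinement (q : Ω → ℝ) (X : Ω → A) (Y : Ω → B) (U : Ω → C) (V : Ω → D) (Γ N δ : ℝ)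
    (x : A) (u : C) (v : D) : Prop :=
  condLaw q V (fun ω => (X ω, U ω)) (x, u) v ≤ Γ * condLaw q V U u v ∧
    prob (condLaw q Y X x) (fun y => ¬ InList q Y U V N u v y) ≤ δ

/-- Given `(X, U) = (x, u)`, the value of `V` is a good refinement up to probability `δ`. -/
def IsRefinable [Fintype D] (q : Ω → ℝ) (X : Ω → A) (Y : Ω → B) (U : Ω → C) (V : Ω → D)
    (Γ N δ : ℝ) (x : A) (u : C) : Prop :=
  prob (condLaw q V (fun ω => (X ω, U ω)) (x, u))
    (fun v => ¬ IsGoodRefinement q X Y U V Γ N δ x u v) ≤ δ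

variable {q : Ω → ℝ} {X : Ω → A} {Y : Ω → B} {U : Ω → C} {V : Ω → D} {Γ N δ : ℝ}

theorem TypicalSink.prob_not_isGoodRefinement_le [Finite A] [Finite C] [Finite D]
    (h : TypicalSink q X Y U V Γ N δ) (hq : ∀ ω, 0 ≤ q ω) (hδ : 0 < δ) :
    prob q (fun ω => ¬ IsGoodRefinement q X Y U V Γ N δ (X ω) (U ω) (V ω)) ≤ δ ^ 3 + δ ^ 2 := by
  have hmiss : prob q (fun ω => δ < prob (condLaw q Y X (X ω))
      fun y => ¬ InList q Y U V N (U ω) (V ω) y) ≤ δ ^ 2 := by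
    refine le_of_mul_le_mul_left ?_ hδ
    calc δ * prob q (fun ω => δ < prob (condLaw q Y X (X ω))
          fun y => ¬ InList q Y U V N (U ω) (V ω) y)
        ≤ δ * prob q (fun ω => δ <
            prob (condLaw q Y (fun ω => (X ω, U ω, V ω)) (X ω, U ω, V ω))
              fun y => ¬ InList q Y U V N (U ω) (V ω) y) := by
          refine mul_le_mul_of_nonneg_left (prob_mono hq fun ω hω hlt => ?_) hδ.le
          rwa [funext (h.isMarkovChain.condLaw_eq hq
            (law_pos hq (fun ω => (X ω, U ω, V ω)) hω).ne')]
      _ ≤ prob q (fun ω => ¬ InList q Y U V N (U ω) (V ω) (Y ω)) :=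
          mul_prob_lt_prob_condLaw_le hq Y (fun ω => (X ω, U ω, V ω))
            (fun a y => ¬ InList q Y U V N a.2.1 a.2.2 y) δ
      _ ≤ δ ^ 3 := (prob_mono hq fun _ _ => not_le.mp).trans h.prob_list_le
      _ = δ * δ ^ 2 := by ring
  refine (prob_mono hq fun ω _ hbad => ?_).trans
    ((prob_or_le hq _ _).trans (add_le_add h.prob_density_le hmiss))
  rwa [← not_le, ← not_le, ← not_and_or]

theorem TypicalSink.prob_not_isRefinable_le [Finite A] [Finite C] [Fintype D]
    (h : TypicalSink q X Y U V Γ N δ) (hq : ∀ ω, 0 ≤ q ω) (hδ : 0 < δ) (hδ1 : δ ≤ 1) :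
    prob q (fun ω => ¬ IsRefinable q X Y U V Γ N δ (X ω) (U ω)) ≤ 2 * δ := by
  refine le_of_mul_le_mul_left ?_ hδ
  calc δ * prob q (fun ω => ¬ IsRefinable q X Y U V Γ N δ (X ω) (U ω))
      ≤ prob q (fun ω => ¬ IsGoodRefinement q X Y U V Γ N δ (X ω) (U ω) (V ω)) := by
        simpa only [IsRefinable, not_le] using mul_prob_lt_prob_condLaw_le hq V
          (fun ω => (X ω, U ω)) (fun a v => ¬ IsGoodRefinement q X Y U V Γ N δ a.1 a.2 v) δ
    _ ≤ δ ^ 3 + δ ^ 2 := h.prob_not_isGoodRefinement_le hq hδ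
    _ ≤ δ * (2 * δ) := by nlinarith [pow_pos hδ 2]

theorem prob_isGoodRefinement_and_not_inList_le [Finite A] (hq : q ∈ stdSimplex ℝ Ω) (hδ : 0 ≤ δ)
    (X : Ω → A) (Y : Ω → B) (U : Ω → C) (V : Ω → D) (Γ N : ℝ) (u : A → C) (v : A → D) :
    prob q (fun ω => IsGoodRefinement q X Y U V Γ N δ (X ω) (u (X ω)) (v (X ω)) ∧
      ¬ InList q Y U V N (u (X ω)) (v (X ω)) (Y ω)) ≤ δ := by
  rw [← sum_mul_prob_condLaw hq.1 Y X fun x y =>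
    IsGoodRefinement q X Y U V Γ N δ x (u x) (v x) ∧ ¬ InList q Y U V N (u x) (v x) y]
  calc _ ≤ ∑ ω, q ω * δ := by
        refine sum_mul_le_sum_mul_of_pos hq.1 fun ω _ => ?_
        by_cases hgood : IsGoodRefinement q X Y U V Γ N δ (X ω) (u (X ω)) (v (X ω))
        · exact (prob_mono (condLaw_nonneg hq.1 Y X _) fun _ _ h => h.2).trans hgood.2
        · simpa [prob, hgood] using hδ
    _ = δ := by rw [← Finset.sum_mul, hq.2, one_mul]

theorem exists_base_code [Finite A] [Finite C] (hq : q ∈ stdSimplex ℝ Ω) (X : Ω → A) (U : Ω → C)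
    (hΓ : 0 < Γ) (hδ : 0 < δ) {M : ℕ} (hM : Γ ≤ δ * M) {P : A → C → Prop}
    (hP : ∀ x u, P x u → condLaw q U X x u ≤ Γ * law q U u) :
    ∃ (c : Fin M → C) (φ : A → Fin M),
      prob q (fun ω => ¬ P (X ω) (c (φ (X ω)))) ≤ prob q (fun ω => ¬ P (X ω) (U ω)) + δ := by
  cases nonempty_fintype A
  cases nonempty_fintype C
  have : Nonempty C := (nonempty_of_mem_stdSimplex hq).map U
  obtain ⟨c, φ, hc⟩ := exists_covering_code (w := law q X) (law_nonneg hq.1 X) (fun _ => ())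
    (r := fun _ => law q U) (fun _ _ => ⟨law_nonneg hq.1 U, by rw [sum_law, hq.2]⟩)
    (W := condLaw q U X) (fun x hx => condLaw_mem_stdSimplex hq.1 U X hx) hΓ
    (fun x u _ => hP x u) (pos_of_le_mul_natCast hΓ hδ hM)
  refine ⟨c (), φ, ?_⟩
  calc prob q (fun ω => ¬ P (X ω) (c () (φ (X ω))))
      = prob (law q X) fun x => ¬ P x (c () (φ x)) :=
        (prob_law q X fun x => ¬ P x (c () (φ x))).symm
    _ ≤ ∑ x, law q X x * (prob (condLaw q U X x) (fun u => ¬ P x u) + Real.exp (-(M / Γ))) := hc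
    _ = prob q (fun ω => ¬ P (X ω) (U ω)) + Real.exp (-(M / Γ)) := by
        rw [sum_law_mul q X fun x => prob (condLaw q U X x) (fun u => ¬ P x u) + _]
        simp only [mul_add, Finset.sum_add_distrib, ← Finset.sum_mul, hq.2, one_mul]
        rw [sum_mul_prob_condLaw hq.1 U X fun x u => ¬ P x u]
    _ ≤ _ := add_le_add_right (exp_neg_div_le hΓ hδ hM) _

variable [Fintype D]

theorem exists_refinement_code {I : Type*} [Finite A] [Finite I] (hq : q ∈ stdSimplex ℝ Ω)
    (X : Ω → A) (Y : Ω → B) (U : Ω → C) (V : Ω → D) (N : ℝ) (hΓ : 0 < Γ) (hδ : 0 < δ) {M : ℕ}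
    (hM : Γ ≤ δ * M) (c₀ : I → C) (φ₀ : A → I) {P : A → C → Prop}
    (hP : ∀ x u, P x u → 0 < law q (fun ω => (X ω, U ω)) (x, u) ∧
      IsRefinable q X Y U V Γ N δ x u) :
    ∃ (c : I → Fin M → D) (φ : A → Fin M), prob q (fun ω => P (X ω) (c₀ (φ₀ (X ω))) ∧
      ¬ IsGoodRefinement q X Y U V Γ N δ (X ω) (c₀ (φ₀ (X ω))) (c (φ₀ (X ω)) (φ (X ω)))) ≤
        2 * δ := by
  classical
  cases nonempty_fintype A
  have : Nonempty D := (nonempty_of_mem_stdSimplex hq).map V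
  set w : A → ℝ := fun x => if P x (c₀ (φ₀ x)) then law q X x else 0
  have hw (x) : 0 ≤ w x := by
    simp only [w]
    split_ifs <;> simp [law_nonneg hq.1]
  have hwP {x} (hx : w x ≠ 0) := hP x _ (ite_ne_right_iff.mp hx).1
  obtain ⟨c, φ, hc⟩ := exists_covering_code hw φ₀ (r := fun i => condLaw q V U (c₀ i))
    (fun x hx => condLaw_mem_stdSimplex hq.1 V U
      ((hwP hx).1.trans_le (law_le_law hq.1 fun ω h => (Prod.mk.inj h).2)).ne')
    (W := fun x => condLaw q V (fun ω => (X ω, U ω)) (x, c₀ (φ₀ x)))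
    (fun x hx => condLaw_mem_stdSimplex hq.1 V _ (hwP hx).1.ne')
    (G := fun x v => IsGoodRefinement q X Y U V Γ N δ x (c₀ (φ₀ x)) v) hΓ
    (fun x v _ h => h.1) (pos_of_le_mul_natCast hΓ hδ hM)
  refine ⟨c, φ, ?_⟩
  rw [← prob_law q X fun x => P x (c₀ (φ₀ x)) ∧
    ¬ IsGoodRefinement q X Y U V Γ N δ x (c₀ (φ₀ x)) (c (φ₀ x) (φ x))]
  calc _ = prob w fun x => ¬ IsGoodRefinement q X Y U V Γ N δ x (c₀ (φ₀ x)) (c (φ₀ x) (φ x)) :=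
        Finset.sum_congr rfl fun x _ => by
          by_cases hPx : P x (c₀ (φ₀ x)) <;> simp [w, hPx]
    _ ≤ _ := hc
    _ ≤ ∑ x, w x * (δ + δ) := sum_mul_le_sum_mul_of_pos hw fun x hx =>
        add_le_add (hwP hx.ne').2 (exp_neg_div_le hΓ hδ hM)
    _ ≤ ∑ x, law q X x * (δ + δ) := by
        refine Finset.sum_le_sum fun x _ => mul_le_mul_of_nonneg_right ?_ (by positivity)
        simp only [w]
        split_ifs <;> simp [law_nonneg hq.1]
    _ = 2 * δ := by rw [← Finset.sum_mul, sum_law, hq.2]; ring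

theorem exists_sink_code {I : Type*} [Finite A] [Finite I] (hq : q ∈ stdSimplex ℝ Ω) (X : Ω → A)
    (Y : Ω → B) (U : Ω → C) (V : Ω → D) (hΓ : 0 < Γ) (hN : 0 < N) (hδ : 0 < δ) {M L : ℕ}
    (hM : Γ ≤ δ * M) (hL : N ≤ δ * L) (c₀ : I → C) (φ₀ : A → I) {P : A → C → Prop}
    (hP : ∀ x u, P x u → 0 < law q (fun ω => (X ω, U ω)) (x, u) ∧
      IsRefinable q X Y U V Γ N δ x u) :
    ∃ (φ : A → Fin M) (b : B → Fin L) (d : I × Fin M × Fin L → B),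
      prob q (fun ω => Y ω ≠ d (φ₀ (X ω), φ (X ω), b (Y ω))) ≤
        prob q (fun ω => ¬ P (X ω) (c₀ (φ₀ (X ω)))) + 4 * δ := by
  obtain ⟨c, φ, hrefine⟩ := exists_refinement_code hq X Y U V N hΓ hδ hM c₀ φ₀ hP
  obtain ⟨b, d, hbin⟩ := exists_binning_code hq Y (fun ω => (φ₀ (X ω), φ (X ω)))
    (fun s => prob_inList_le hq.1 Y U V hN.le (c₀ s.1) (c s.1 s.2))
    (pos_of_le_mul_natCast hN hδ hL)
  have hbinδ := hbin.trans <| (div_le_iff₀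
    (Nat.cast_pos.mpr (pos_of_le_mul_natCast hN hδ hL))).mpr hL
  have hmiss := prob_isGoodRefinement_and_not_inList_le hq hδ.le X Y U V Γ N
    (fun x => c₀ (φ₀ x)) fun x => c (φ₀ x) (φ x)
  refine ⟨φ, b, fun s => d (s.1, s.2.1) s.2.2, ?_⟩
  refine (prob_mono hq.1 fun ω _ herr => ?_).trans <| ((prob_or_le hq.1 _ _).trans <|
    add_le_add_right ((prob_or_le hq.1 _ _).trans <| add_le_add hrefine <|
      (prob_or_le hq.1 _ _).trans <| add_le_add hmiss hbinδ) _).trans_eq (by ring)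
  by_contra! hok
  obtain ⟨hPω, hgood, hlist, hdec⟩ := hok
  exact herr (hdec (hlist (hgood hPω))).symm

end Sink

theorem exists_oneShot_code {A C B₁ B₂ D₁ D₂ : Type*} [Finite A] [Finite B₁] [Finite B₂]
    [Finite C] [Finite D₁] [Finite D₂] {q : Ω → ℝ} (hq : q ∈ stdSimplex ℝ Ω)
    (X : Ω → A) (Y₁ : Ω → B₁) (Y₂ : Ω → B₂) (U : Ω → C) (V₁ : Ω → D₁) (V₂ : Ω → D₂)
    {Γ₀ Γ₁ Γ₂ N₁ N₂ δ : ℝ} (hΓ₀ : 0 < Γ₀) (hΓ₁ : 0 < Γ₁) (hΓ₂ : 0 < Γ₂) (hN₁ : 0 < N₁)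
    (hN₂ : 0 < N₂) (hδ : 0 < δ) (hδ1 : δ ≤ 1) {M₀ M₁ M₂ L₁ L₂ : ℕ} (hM₀ : Γ₀ ≤ δ * M₀)
    (hM₁ : Γ₁ ≤ δ * M₁) (hM₂ : Γ₂ ≤ δ * M₂) (hL₁ : N₁ ≤ δ * L₁) (hL₂ : N₂ ≤ δ * L₂)
    (hbase : prob q (fun ω => Γ₀ * law q U (U ω) < condLaw q U X (X ω) (U ω)) ≤ δ ^ 3)
    (hsink₁ : TypicalSink q X Y₁ U V₁ Γ₁ N₁ δ) (hsink₂ : TypicalSink q X Y₂ U V₂ Γ₂ N₂ δ) :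
    ∃ (φ₀ : A → Fin M₀) (φ₁ : A → Fin M₁) (φ₂ : A → Fin M₂) (b₁ : B₁ → Fin L₁)
      (b₂ : B₂ → Fin L₂) (d₁ : Fin M₀ × Fin M₁ × Fin L₁ → B₁)
      (d₂ : Fin M₀ × Fin M₂ × Fin L₂ → B₂),
      prob q (fun ω => Y₁ ω ≠ d₁ (φ₀ (X ω), φ₁ (X ω), b₁ (Y₁ ω))) ≤ 10 * δ ∧
      prob q (fun ω => Y₂ ω ≠ d₂ (φ₀ (X ω), φ₂ (X ω), b₂ (Y₂ ω))) ≤ 10 * δ := by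
  cases nonempty_fintype B₁
  cases nonempty_fintype B₂
  cases nonempty_fintype D₁
  cases nonempty_fintype D₂
  -- The base codebook serves both sinks, so its codeword has to be refinable for both.
  set P : A → C → Prop := fun x u => 0 < law q (fun ω => (X ω, U ω)) (x, u) ∧
    condLaw q U X x u ≤ Γ₀ * law q U u ∧
    IsRefinable q X Y₁ U V₁ Γ₁ N₁ δ x u ∧ IsRefinable q X Y₂ U V₂ Γ₂ N₂ δ x u
  have hP : prob q (fun ω => ¬ P (X ω) (U ω)) ≤ δ ^ 3 + (2 * δ + 2 * δ) := by
    refine (prob_mono hq.1 fun ω hω hfail => ?_).trans <| (prob_or_le hq.1 _ _).trans <|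
      add_le_add hbase <| (prob_or_le hq.1 _ _).trans <| add_le_add
        (hsink₁.prob_not_isRefinable_le hq.1 hδ hδ1) (hsink₂.prob_not_isRefinable_le hq.1 hδ hδ1)
    by_contra! hok
    exact hfail ⟨law_pos hq.1 (fun ω => (X ω, U ω)) hω, hok⟩
  have hδ3 : δ ^ 3 ≤ δ := pow_le_of_le_one hδ.le hδ1 three_ne_zero
  obtain ⟨c₀, φ₀, h₀⟩ := exists_base_code hq X U hΓ₀ hδ hM₀ (P := P) fun x u h => h.2.1
  obtain ⟨φ₁, b₁, d₁, h₁⟩ := exists_sink_code hq X Y₁ U V₁ hΓ₁ hN₁ hδ hM₁ hL₁ c₀ φ₀ (P := P)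
    fun x u h => ⟨h.1, h.2.2.1⟩
  obtain ⟨φ₂, b₂, d₂, h₂⟩ := exists_sink_code hq X Y₂ U V₂ hΓ₂ hN₂ hδ hM₂ hL₂ c₀ φ₀ (P := P)
    fun x u h => ⟨h.1, h.2.2.2⟩
  exact ⟨φ₀, φ₁, φ₂, b₁, b₂, d₁, d₂, by linarith, by linarith⟩

end OneShot

section Asymptotics

open Filter Topology

variable {Ω A B C D : Type*} [Fintype Ω]

theorem exists_pos_sum_mul_exp_lt_one {q f : Ω → ℝ} (hq : ∑ ω, q ω = 1)
    (hf : ∑ ω, q ω * f ω < 0) : ∃ s, 0 < s ∧ ∑ ω, q ω * Real.exp (s * f ω) < 1 := by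
  have hderiv : HasDerivAt (fun s => ∑ ω, q ω * Real.exp (s * f ω)) (∑ ω, q ω * f ω) 0 := by
    simpa using HasDerivAt.fun_sum (u := Finset.univ) fun ω _ =>
      (((hasDerivAt_id (0 : ℝ)).mul_const (f ω)).exp).const_mul (q ω)
  have hright := (hasDerivWithinAt_iff_tendsto_slope' Set.self_notMem_Ioi).mp
    (hderiv.hasDerivWithinAt (s := Set.Ioi 0))
  obtain ⟨s, hslope, hs⟩ := ((hright.eventually_lt_const hf).and self_mem_nhdsWithin).exists
  refine ⟨s, hs, ?_⟩
  rw [slope_def_field, sub_zero, div_lt_iff₀ hs] at hslope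
  simpa [hq] using hslope

theorem tendsto_prob_sum_pos {q f : Ω → ℝ} (hq : q ∈ stdSimplex ℝ Ω)
    (hf : ∑ ω, q ω * f ω < 0) :
    Tendsto (fun n : ℕ => prob (iidMass n q) fun x => 0 < ∑ i, f (x i)) atTop (𝓝 0) := by
  classical
  -- Chernoff's bound: the indicator of `0 < ∑ f` is at most `exp (s * ∑ f)`.
  obtain ⟨s, hs, hs1⟩ := exists_pos_sum_mul_exp_lt_one hq.2 hf
  refine squeeze_zero (fun n => prob_nonneg (iidMass_mem_stdSimplex n hq).1 _) (fun n => ?_)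
    (tendsto_pow_atTop_nhds_zero_of_lt_one
      (Finset.sum_nonneg fun ω _ => mul_nonneg (hq.1 ω) (Real.exp_pos (s * f ω)).le) hs1)
  calc prob (iidMass n q) (fun x => 0 < ∑ i, f (x i))
      ≤ ∑ x, iidMass n q x * ∏ i, Real.exp (s * f (x i)) := by
        rw [prob_eq_sum_mul]
        refine Finset.sum_le_sum fun x _ =>
          mul_le_mul_of_nonneg_left ?_ ((iidMass_mem_stdSimplex n hq).1 x)
        rw [← Real.exp_sum, ← Finset.mul_sum]
        split_ifs with hx
        · exact Real.one_le_exp (mul_nonneg hs.le hx.le)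
        · exact (Real.exp_pos _).le
    _ = (∑ ω, q ω * Real.exp (s * f ω)) ^ n := by
        rw [sum_iidMass_mul_prod n q fun _ ω => Real.exp (s * f ω), Finset.prod_const,
          Finset.card_univ, Fintype.card_fin]

theorem tendsto_prob_prod_lt_prod {q f g : Ω → ℝ} (hq : q ∈ stdSimplex ℝ Ω)
    (hf : ∀ ω, 0 < q ω → 0 < f ω) (hg : ∀ ω, 0 < q ω → 0 < g ω) {η : ℝ} (hη : 0 < η) :
    Tendsto (fun n : ℕ => prob (iidMass n q) fun x =>
      (2 : ℝ) ^ (n * ((∑ ω, q ω * Real.logb 2 (f ω / g ω)) + η)) * ∏ i, g (x i) <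
        ∏ i, f (x i)) atTop (𝓝 0) := by
  set e := ∑ ω, q ω * Real.logb 2 (f ω / g ω)
  have hneg : ∑ ω, q ω * (Real.logb 2 (f ω / g ω) - (e + η)) < 0 := by
    simp only [mul_sub, Finset.sum_sub_distrib, ← Finset.sum_mul, hq.2]
    linarith
  refine squeeze_zero (fun n => prob_nonneg (iidMass_mem_stdSimplex n hq).1 _)
    (fun n => prob_mono (iidMass_mem_stdSimplex n hq).1 fun x hx hlt => ?_)
    (tendsto_prob_sum_pos hq hneg)
  have hfx (i) : 0 < f (x i) := hf _ (pos_of_iidMass_pos hq.1 hx i)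
  have hgx (i) : 0 < g (x i) := hg _ (pos_of_iidMass_pos hq.1 hx i)
  have hprod : (2 : ℝ) ^ (n * (e + η)) < ∏ i, f (x i) / g (x i) := by
    rwa [Finset.prod_div_distrib, lt_div_iff₀ (Finset.prod_pos fun i _ => hgx i)]
  have hlog := Real.logb_lt_logb one_lt_two (by positivity) hprod
  rw [Real.logb_rpow two_pos (by norm_num),
    Real.logb_prod _ _ fun i _ => (div_pos (hfx i) (hgx i)).ne'] at hlog
  rwa [Finset.sum_sub_distrib, sub_pos, Finset.sum_const, Finset.card_univ, Fintype.card_fin,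
    nsmul_eq_mul]

theorem law_iidMass_comp (n : ℕ) (q : Ω → ℝ) (X : Ω → A) (a : Fin n → A) :
    law (iidMass n q) (fun x i => X (x i)) a = ∏ i, law q X (a i) :=
  law_iidMass n q (fun _ => X) a

theorem law_iidMass_pair (n : ℕ) (q : Ω → ℝ) (X : Fin n → Ω → A) (Y : Fin n → Ω → B)
    (a : Fin n → A) (b : Fin n → B) :
    law (iidMass n q) (fun x => ((fun i => X i (x i)), fun i => Y i (x i))) (a, b) =
      ∏ i, law q (fun ω => (X i ω, Y i ω)) (a i, b i) := by
  rw [← law_iidMass n q (fun i ω => (X i ω, Y i ω)) fun i => (a i, b i)]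
  exact law_congr _ fun x => by simp [funext_iff, forall_and]

theorem law_iidMass_triple (n : ℕ) (q : Ω → ℝ) (X : Fin n → Ω → A) (Y : Fin n → Ω → B)
    (Z : Fin n → Ω → C) (a : Fin n → A) (b : Fin n → B) (c : Fin n → C) :
    law (iidMass n q)
      (fun x => ((fun i => X i (x i)), (fun i => Y i (x i)), fun i => Z i (x i))) (a, b, c) =
      ∏ i, law q (fun ω => (X i ω, Y i ω, Z i ω)) (a i, b i, c i) := by
  rw [← law_iidMass_pair n q X (fun i ω => (Y i ω, Z i ω)) a fun i => (b i, c i)]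
  exact law_congr _ fun x => by simp [funext_iff, forall_and]

theorem condLaw_iidMass (n : ℕ) (q : Ω → ℝ) (X : Ω → A) (Y : Ω → B) (b : Fin n → B)
    (a : Fin n → A) :
    condLaw (iidMass n q) (fun x i => X (x i)) (fun x i => Y (x i)) b a =
      ∏ i, condLaw q X Y (b i) (a i) := by
  simp only [condLaw, law_iidMass_pair n q (fun _ => X) (fun _ => Y), law_iidMass_comp,
    Finset.prod_div_distrib]

theorem condLaw_iidMass_pair (n : ℕ) (q : Ω → ℝ) (X : Ω → A) (Y : Ω → B) (Z : Ω → C)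
    (b : Fin n → B) (c : Fin n → C) (a : Fin n → A) :
    condLaw (iidMass n q) (fun x i => X (x i)) (fun x => ((fun i => Y (x i)), fun i => Z (x i)))
      (b, c) a = ∏ i, condLaw q X (fun ω => (Y ω, Z ω)) (b i, c i) (a i) := by
  simp only [condLaw, law_iidMass_triple n q (fun _ => X) (fun _ => Y) (fun _ => Z),
    law_iidMass_pair n q (fun _ => Y) (fun _ => Z), Finset.prod_div_distrib]

theorem IsMarkovChain.iidMass {n : ℕ} {q : Ω → ℝ} {X : Fin n → Ω → A} {Y : Fin n → Ω → B}
    {Z : Fin n → Ω → C} (h : ∀ i, IsMarkovChain q (X i) (Y i) (Z i)) :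
    IsMarkovChain (iidMass n q) (fun x i => X i (x i)) (fun x i => Y i (x i))
      fun x i => Z i (x i) := by
  intro a b c
  rw [law_iidMass_triple, law_iidMass, law_iidMass_pair, law_iidMass_pair,
    ← Finset.prod_mul_distrib, ← Finset.prod_mul_distrib]
  exact Finset.prod_congr rfl fun i _ => h i (a i) (b i) (c i)

theorem tendsto_prob_density [Fintype A] [Fintype B] {q : Ω → ℝ} (hq : q ∈ stdSimplex ℝ Ω)
    (X : Ω → A) (U : Ω → B) {η : ℝ} (hη : 0 < η) :
    Tendsto (fun n : ℕ => prob (iidMass n q) fun x =>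
      (2 : ℝ) ^ (n * (mutualInfo q X U + η)) *
        law (iidMass n q) (fun x j => U (x j)) (fun j => U (x j)) <
      condLaw (iidMass n q) (fun x j => U (x j)) (fun x j => X (x j)) (fun j => X (x j))
        fun j => U (x j)) atTop (𝓝 0) := by
  simp only [law_iidMass_comp, condLaw_iidMass, mutualInfo_eq_sum]
  exact tendsto_prob_prod_lt_prod hq (fun _ => condLaw_pos hq.1 U X) (fun _ => law_pos hq.1 U) hη

theorem tendsto_prob_condDensity [Fintype A] [Fintype B] [Fintype C] {q : Ω → ℝ}
    (hq : q ∈ stdSimplex ℝ Ω) (X : Ω → A) (V : Ω → B) (U : Ω → C) {η : ℝ} (hη : 0 < η) :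
    Tendsto (fun n : ℕ => prob (iidMass n q) fun x =>
      (2 : ℝ) ^ (n * (condMutualInfo q X V U + η)) *
        condLaw (iidMass n q) (fun x j => V (x j)) (fun x j => U (x j)) (fun j => U (x j))
          (fun j => V (x j)) <
      condLaw (iidMass n q) (fun x j => V (x j))
        (fun x => ((fun j => X (x j)), fun j => U (x j)))
        ((fun j => X (x j)), fun j => U (x j)) fun j => V (x j)) atTop (𝓝 0) := by
  simp only [condLaw_iidMass, condLaw_iidMass_pair, condMutualInfo_eq_sum hq.1]
  exact tendsto_prob_prod_lt_prod hq (fun _ => condLaw_pos hq.1 V fun ω => (X ω, U ω))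
    (fun _ => condLaw_pos hq.1 V U) hη

theorem tendsto_prob_mul_condLaw_lt_one [Fintype A] [Fintype B] [Fintype C] {q : Ω → ℝ}
    (hq : q ∈ stdSimplex ℝ Ω) (Y : Ω → A) (U : Ω → B) (V : Ω → C) {η : ℝ} (hη : 0 < η) :
    Tendsto (fun n : ℕ => prob (iidMass n q) fun x =>
      (2 : ℝ) ^ (n * (condEntropy q Y (fun ω => (U ω, V ω)) + η)) *
        condLaw (iidMass n q) (fun x j => Y (x j))
          (fun x => ((fun j => U (x j)), fun j => V (x j)))
          ((fun j => U (x j)), fun j => V (x j)) (fun j => Y (x j)) < 1) atTop (𝓝 0) := by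
  simp only [condLaw_iidMass_pair, condEntropy_eq_sum]
  simpa only [one_div, Real.logb_inv, Finset.prod_const_one] using
    tendsto_prob_prod_lt_prod hq (f := fun _ => 1) (fun _ _ => one_pos)
      (fun _ => condLaw_pos hq.1 Y fun ω => (U ω, V ω)) hη

theorem eventually_typicalSink [Fintype A] [Fintype B] [Fintype C] [Fintype D] {q : Ω → ℝ}
    (hq : q ∈ stdSimplex ℝ Ω) {X : Ω → A} {Y : Ω → B} {U : Ω → C} {V : Ω → D}
    (h : IsMarkovChain q Y X fun ω => (U ω, V ω)) {η δ : ℝ} (hη : 0 < η) (hδ : 0 < δ) :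
    ∀ᶠ n : ℕ in atTop, TypicalSink (iidMass n q) (fun x j => X (x j)) (fun x j => Y (x j))
      (fun x j => U (x j)) (fun x j => V (x j)) (2 ^ (n * (condMutualInfo q X V U + η)))
      (2 ^ (n * (condEntropy q Y (fun ω => (U ω, V ω)) + η))) δ := by
  filter_upwards [(tendsto_prob_condDensity hq X V U hη).eventually_le_const (pow_pos hδ 3),
    (tendsto_prob_mul_condLaw_lt_one hq Y U V hη).eventually_le_const (pow_pos hδ 3)]
    with n hdensity hlist
  exact ⟨(IsMarkovChain.iidMass fun _ => h).comp_right
    fun z => ((fun i => (z i).1), fun i => (z i).2), hdensity, hlist⟩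

theorem eventually_exists_index_size {I R η δ : ℝ} (hI : 0 ≤ I) (hR : I ≤ R) (hη : 0 < η)
    (hδ : 0 < δ) : ∀ᶠ n : ℕ in atTop, ∃ M : ℕ,
      1 / (n : ℝ) * Real.logb 2 M ≤ R + η ∧ (2 : ℝ) ^ (n * (I + η / 2)) ≤ δ * M := by
  have hgrow : Tendsto (fun n : ℕ => (2 : ℝ) ^ (n * (η / 2))) atTop atTop :=
    (tendsto_rpow_atTop_of_base_gt_one 2 one_lt_two).comp
      (tendsto_natCast_atTop_atTop.atTop_mul_const (half_pos hη))
  filter_upwards [hgrow.eventually_ge_atTop (1 / δ + 1), eventually_gt_atTop 0] with n hn hn0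
  have hn' : (0 : ℝ) < n := Nat.cast_pos.mpr hn0
  set K : ℝ := 2 ^ (n * (R + η))
  have hK : 1 ≤ K := Real.one_le_rpow one_le_two (mul_nonneg hn'.le (by linarith))
  have hΓ : (1 : ℝ) ≤ 2 ^ (n * (I + η / 2)) := Real.one_le_rpow one_le_two (by positivity)
  have hgap : (2 : ℝ) ^ (n * (I + η / 2)) * (1 / δ + 1) ≤ K := by
    refine (mul_le_mul_of_nonneg_left hn (by positivity)).trans ?_
    rw [← Real.rpow_add two_pos]
    refine Real.rpow_le_rpow_of_exponent_le one_le_two ?_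
    nlinarith
  refine ⟨⌊K⌋₊, ?_, ?_⟩
  · rw [one_div, inv_mul_le_iff₀ hn']
    calc Real.logb 2 ⌊K⌋₊ ≤ Real.logb 2 K :=
          Real.logb_le_logb_of_le one_lt_two (Nat.cast_pos.mpr (Nat.floor_pos.mpr hK))
            (Nat.floor_le (by positivity))
      _ = n * (R + η) := Real.logb_rpow two_pos (by norm_num)
  · have hfloor : (2 : ℝ) ^ (n * (I + η / 2)) * (1 / δ) ≤ ⌊K⌋₊ := by
      linarith [Nat.lt_floor_add_one K]
    rw [mul_one_div, div_le_iff₀ hδ] at hfloor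
    linarith

end Asymptotics

section Achievability

open Filter Topology

variable {𝒳₀ 𝒳₁ 𝒳₂ 𝒰₀ 𝒰₁ 𝒰₂ : Type*} [Fintype 𝒳₀] [Fintype 𝒳₁] [Fintype 𝒳₂]

theorem Code.errorProb_eq {n : ℕ} (c : Code n 𝒳₀ 𝒳₁ 𝒳₂) (p : 𝒳₀ × 𝒳₁ × 𝒳₂ → ℝ) :
    c.errorProb p = 1 / 2 * (prob (iidMass n p) (fun x => (fun i => (x i).2.1) ≠ c.est₁ x) +
      prob (iidMass n p) fun x => (fun i => (x i).2.2) ≠ c.est₂ x) := by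
  unfold Code.errorProb prob iidMass
  congr! 6

variable [Fintype 𝒰₀] [Fintype 𝒰₁] [Fintype 𝒰₂] {p : 𝒳₀ × 𝒳₁ × 𝒳₂ → ℝ}
  {q : (𝒳₀ × 𝒳₁ × 𝒳₂) × (𝒰₀ × 𝒰₁ × 𝒰₂) → ℝ}

theorem IsAuxiliary.iidMass_eq (h : IsAuxiliary p q) (n : ℕ) :
    iidMass n p = law (iidMass n q) fun x j => (x j).1 := by
  classical
  funext x
  rw [law_iidMass_comp n q Prod.fst]
  refine Finset.prod_congr rfl fun j _ => ?_
  rw [← h.2.1 (x j), ← sum_law_pair_left q Prod.fst Prod.snd]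
  exact Finset.sum_congr rfl fun u _ => (congrFun (law_id q) (x j, u)).symm

theorem IsAuxiliary.achievable (h : IsAuxiliary p q) {R : Packet → ℝ} (hR : R ∈ infoRegion q) :
    Achievable p R := by
  intro η hη ε hε hε1
  obtain ⟨hR₀, hR₁, hR₂, hS₁, hS₂⟩ := hR
  have hq := h.1
  have hδ : 0 < ε / 20 := by positivity
  have hMarkov₁ := h.2.2.1.comp_right fun u : 𝒰₀ × 𝒰₁ × 𝒰₂ => (u.1, u.2.1)
  have hMarkov₂ := h.2.2.2.comp_right fun u : 𝒰₀ × 𝒰₁ × 𝒰₂ => (u.1, u.2.2)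
  filter_upwards [
    eventually_exists_index_size (mutualInfo_nonneg hq _ _) hR₀ hη hδ,
    eventually_exists_index_size (condMutualInfo_nonneg hq _ _ _) hR₁ hη hδ,
    eventually_exists_index_size (condMutualInfo_nonneg hq _ _ _) hR₂ hη hδ,
    eventually_exists_index_size (condEntropy_nonneg hq.1 _ _) hS₁ hη hδ,
    eventually_exists_index_size (condEntropy_nonneg hq.1 _ _) hS₂ hη hδ,
    (tendsto_prob_density hq (fun ω => ω.1.1) (fun ω => ω.2.1) (half_pos hη)).eventually_le_const
      (pow_pos hδ 3),
    eventually_typicalSink hq hMarkov₁ (half_pos hη) hδ,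
    eventually_typicalSink hq hMarkov₂ (half_pos hη) hδ]
    with n ⟨M₀, hM₀, hΓ₀⟩ ⟨M₁, hM₁, hΓ₁⟩ ⟨M₂, hM₂, hΓ₂⟩ ⟨L₁, hL₁, hN₁⟩ ⟨L₂, hL₂, hN₂⟩
      hbase hsink₁ hsink₂
  obtain ⟨φ₀, φ₁, φ₂, b₁, b₂, d₁, d₂, herr₁, herr₂⟩ := exists_oneShot_code
    (iidMass_mem_stdSimplex n hq) _ _ _ _ _ _ (by positivity) (by positivity) (by positivity)
    (by positivity) (by positivity) hδ (by linarith) hΓ₀ hΓ₁ hΓ₂ hN₁ hN₂ hbase hsink₁ hsink₂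
  refine ⟨⟨fun | .p012 => M₀ | .p01 => M₁ | .p02 => M₂ | .p1 => L₁ | .p2 => L₂,
    fun x => (φ₀ x, φ₁ x, φ₂ x), b₁, b₂, d₁, d₂⟩, ?_, ?_⟩
  · rintro (_ | _ | _ | _ | _) <;> assumption
  · rw [Code.errorProb_eq, h.iidMass_eq, prob_law, prob_law]
    simp only [Code.est₁, Code.est₂]
    linarith

end Achievability

section InformationIdentities

variable {Ω A B C D : Type*} [Fintype Ω] {q : Ω → ℝ}

theorem IsMarkovChain.symm {X : Ω → A} {Y : Ω → B} {Z : Ω → C} (h : IsMarkovChain q X Y Z) :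
    IsMarkovChain q Z Y X := by
  intro z y x
  rw [law_congr q (X := fun ω => (Z ω, Y ω, X ω)) (Y := fun ω => (X ω, Y ω, Z ω))
    (b := (x, y, z)) fun ω => by simp only [Prod.mk.injEq]; tauto, h, law_swap q X, law_swap q Y Z]
  ring

theorem isMarkovChain_of_determines (X : Ω → A) {Y : Ω → B} {Z : Ω → C}
    (h : ∀ ω ω', Y ω = Y ω' → Z ω = Z ω') : IsMarkovChain q X Y Z := by
  intro x y z
  by_cases hyz : ∃ ω, Y ω = y ∧ Z ω = z
  · obtain ⟨ω₀, rfl, rfl⟩ := hyz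
    congr 1
    · exact law_congr q fun ω => by simpa using fun _ hY => h ω ω₀ hY
    · exact law_congr q fun ω => by simpa using h ω ω₀
  · push Not at hyz
    have hYZ : law q (fun ω => (Y ω, Z ω)) (y, z) = 0 :=
      Finset.sum_eq_zero fun ω _ => if_neg fun hω =>
        hyz ω (Prod.mk.inj hω).1 (Prod.mk.inj hω).2
    have hXYZ : law q (fun ω => (X ω, Y ω, Z ω)) (x, y, z) = 0 :=
      Finset.sum_eq_zero fun ω _ => if_neg fun hω =>
        hyz ω (Prod.mk.inj (Prod.mk.inj hω).2).1 (Prod.mk.inj (Prod.mk.inj hω).2).2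
    rw [hXYZ, hYZ, zero_mul, mul_zero]

theorem IsMarkovChain.of_injective {A' B' : Type*} {X : Ω → A} {Y : Ω → B} {Z : Ω → C}
    {f : A → A'} {g : B → B'} (hf : f.Injective) (hg : g.Injective)
    (h : IsMarkovChain q (fun ω => f (X ω)) (fun ω => g (Y ω)) Z) : IsMarkovChain q X Y Z := by
  intro x y z
  rw [law_congr q (X := Y) (Y := fun ω => g (Y ω)) (b := g y) (by simp [hg.eq_iff]),
    law_congr q (X := fun ω => (X ω, Y ω)) (Y := fun ω => (f (X ω), g (Y ω))) (b := (f x, g y))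
      (by simp [hf.eq_iff, hg.eq_iff]),
    law_congr q (X := fun ω => (Y ω, Z ω)) (Y := fun ω => (g (Y ω), Z ω)) (b := (g y, z))
      (by simp [hg.eq_iff]),
    law_congr q (X := fun ω => (X ω, Y ω, Z ω)) (Y := fun ω => (f (X ω), g (Y ω), Z ω))
      (b := (f x, g y, z)) (by simp [hf.eq_iff, hg.eq_iff])]
  exact h _ _ _

theorem isMarkovChain_law_iff [Fintype D] {W : Ω → D} {X : D → A} {Y : D → B} {Z : D → C} :
    IsMarkovChain (law q W) X Y Z ↔
      IsMarkovChain q (fun ω => X (W ω)) (fun ω => Y (W ω)) fun ω => Z (W ω) := by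
  simp only [IsMarkovChain, law_law]

theorem IsMarkovChain.entropy_eq {X : Ω → A} {Y : Ω → B} {Z : Ω → C}
    (h : IsMarkovChain q X Y Z) (hq : ∀ ω, 0 ≤ q ω) :
    entropy q (fun ω => (X ω, Y ω, Z ω)) + entropy q Y =
      entropy q (fun ω => (X ω, Y ω)) + entropy q (fun ω => (Y ω, Z ω)) := by
  simp only [entropy, ← Finset.sum_add_distrib, ← mul_add]
  refine sum_mul_eq_sum_mul_of_pos hq fun ω hω => ?_
  have hlog := congrArg (Real.logb 2) (h (X ω) (Y ω) (Z ω))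
  rw [Real.logb_mul (law_pos hq (fun ω => (X ω, Y ω, Z ω)) hω).ne' (law_pos hq Y hω).ne',
    Real.logb_mul (law_pos hq (fun ω => (X ω, Y ω)) hω).ne'
      (law_pos hq (fun ω => (Y ω, Z ω)) hω).ne'] at hlog
  linarith

variable [Fintype A] [Fintype B]

theorem condEntropy_law [Fintype D] (q : Ω → ℝ) (W : Ω → D) (X : D → A) (Y : D → B) :
    condEntropy (law q W) X Y = condEntropy q (fun ω => X (W ω)) fun ω => Y (W ω) := by
  simp only [condEntropy, law_law]

theorem mutualInfo_law [Fintype D] (q : Ω → ℝ) (W : Ω → D) (X : D → A) (U : D → B) :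
    mutualInfo (law q W) X U = mutualInfo q (fun ω => X (W ω)) fun ω => U (W ω) := by
  simp only [mutualInfo, law_law]

theorem condEntropy_congr {A' B' : Type*} [Fintype A'] [Fintype B'] (hq : ∀ ω, 0 ≤ q ω)
    {X : Ω → A} {X' : Ω → A'} {Y : Ω → B} {Y' : Ω → B'}
    (hX : ∀ ω ω', X ω = X ω' ↔ X' ω = X' ω') (hY : ∀ ω ω', Y ω = Y ω' ↔ Y' ω = Y' ω') :
    condEntropy q X Y = condEntropy q X' Y' := by
  rw [condEntropy_eq hq, condEntropy_eq hq, entropy_congr q hY, entropy_congr q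
    (X := fun ω => (X ω, Y ω)) (Y := fun ω => (X' ω, Y' ω)) (by simp [hX, hY])]

theorem mutualInfo_congr {A' B' : Type*} [Fintype A'] [Fintype B'] (hq : ∀ ω, 0 ≤ q ω)
    {X : Ω → A} {X' : Ω → A'} {U : Ω → B} {U' : Ω → B'}
    (hX : ∀ ω ω', X ω = X ω' ↔ X' ω = X' ω') (hU : ∀ ω ω', U ω = U ω' ↔ U' ω = U' ω') :
    mutualInfo q X U = mutualInfo q X' U' := by
  rw [mutualInfo_eq hq, mutualInfo_eq hq, entropy_congr q hX, entropy_congr q hU,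
    entropy_congr q (X := fun ω => (X ω, U ω)) (Y := fun ω => (X' ω, U' ω)) (by simp [hX, hU])]

theorem mutualInfo_eq_sub_condEntropy (hq : ∀ ω, 0 ≤ q ω) (X : Ω → A) (U : Ω → B) :
    mutualInfo q X U = entropy q X - condEntropy q X U := by
  rw [mutualInfo_eq hq, condEntropy_eq hq]
  ring

theorem mutualInfo_le_entropy (hq : ∀ ω, 0 ≤ q ω) (X : Ω → A) (U : Ω → B) :
    mutualInfo q X U ≤ entropy q U := by
  rw [mutualInfo_eq hq]
  linarith [entropy_mono hq (X := X) (Y := fun ω => (X ω, U ω)) fun _ _ h => (Prod.mk.inj h).1]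

theorem condEntropy_le_entropy_add_prob_ne_mul (hq : q ∈ stdSimplex ℝ Ω) (Y : Ω → A) (S : Ω → B)
    (T : Ω → C) (d : B → C → A) :
    condEntropy q Y S ≤ entropy q T +
      (1 + prob q (fun ω => Y ω ≠ d (S ω) (T ω)) * Real.logb 2 (Fintype.card A)) := by
  have hfano := entropy_pair_le_entropy_add_prob_ne_mul hq Y fun ω => d (S ω) (T ω)
  have hsub := entropy_submodular hq Y (fun ω => (S ω, T ω)) fun ω => d (S ω) (T ω)
  have hYS := entropy_mono hq.1 (X := fun ω => (Y ω, S ω))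
    (Y := fun ω => (Y ω, (S ω, T ω), d (S ω) (T ω))) (by simp +contextual)
  have hST := entropy_congr q (X := fun ω => ((S ω, T ω), d (S ω) (T ω)))
    (Y := fun ω => (S ω, T ω)) (by simp +contextual)
  rw [condEntropy_eq hq.1]
  linarith [entropy_pair_le hq S T]

variable [Fintype C]

theorem condMutualInfo_law [Fintype D] (q : Ω → ℝ) (W : Ω → D) (X : D → A) (V : D → B)
    (U : D → C) : condMutualInfo (law q W) X V U =
      condMutualInfo q (fun ω => X (W ω)) (fun ω => V (W ω)) fun ω => U (W ω) := by
  simp only [condMutualInfo, law_law]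

theorem condMutualInfo_congr {A' B' C' : Type*} [Fintype A'] [Fintype B'] [Fintype C']
    (hq : ∀ ω, 0 ≤ q ω) {X : Ω → A} {X' : Ω → A'} {V : Ω → B} {V' : Ω → B'} {U : Ω → C}
    {U' : Ω → C'} (hX : ∀ ω ω', X ω = X ω' ↔ X' ω = X' ω')
    (hV : ∀ ω ω', V ω = V ω' ↔ V' ω = V' ω') (hU : ∀ ω ω', U ω = U ω' ↔ U' ω = U' ω') :
    condMutualInfo q X V U = condMutualInfo q X' V' U' := by
  rw [condMutualInfo_eq hq, condMutualInfo_eq hq, entropy_congr q hU,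
    entropy_congr q (X := fun ω => (X ω, U ω)) (Y := fun ω => (X' ω, U' ω)) (by simp [hX, hU]),
    entropy_congr q (X := fun ω => (V ω, U ω)) (Y := fun ω => (V' ω, U' ω)) (by simp [hV, hU]),
    entropy_congr q (X := fun ω => (X ω, V ω, U ω)) (Y := fun ω => (X' ω, V' ω, U' ω))
      (by simp [hX, hV, hU])]

theorem condMutualInfo_eq_sub_condEntropy (hq : ∀ ω, 0 ≤ q ω) (X : Ω → A) (V : Ω → B)
    (U : Ω → C) :
    condMutualInfo q X V U = condEntropy q X U - condEntropy q X (fun ω => (V ω, U ω)) := by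
  rw [condMutualInfo_eq hq, condEntropy_eq hq, condEntropy_eq hq]
  ring

theorem condMutualInfo_le_entropy (hq : q ∈ stdSimplex ℝ Ω) (X : Ω → A) (V : Ω → B) (U : Ω → C) :
    condMutualInfo q X V U ≤ entropy q V := by
  rw [condMutualInfo_eq hq.1]
  have hXU := entropy_mono hq.1 (X := fun ω => (X ω, U ω)) (Y := fun ω => (X ω, V ω, U ω))
    (by simp +contextual)
  linarith [entropy_pair_le hq V U]

theorem IsMarkovChain.condEntropy_le [Fintype D] (hq : q ∈ stdSimplex ℝ Ω) {X : Ω → A} {Y : Ω → B}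
    {S : Ω → C} {W : Ω → D} (h : IsMarkovChain q X Y fun ω => (S ω, W ω)) :
    condEntropy q W (fun ω => (S ω, Y ω)) ≤ condEntropy q W (fun ω => (S ω, X ω)) := by
  have hWS := h.entropy_eq hq.1
  have hS := (h.comp_right Prod.fst).entropy_eq hq.1
  have hsub := entropy_submodular hq W Y fun ω => (S ω, X ω)
  rw [condEntropy_eq hq.1, condEntropy_eq hq.1]
  have hWYSX := entropy_congr q (X := fun ω => (X ω, Y ω, S ω, W ω))
    (Y := fun ω => (W ω, Y ω, S ω, X ω)) fun _ _ => by simp only [Prod.mk.injEq]; tauto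
  have hYSW := entropy_congr q (X := fun ω => (Y ω, S ω, W ω))
    (Y := fun ω => (W ω, S ω, Y ω)) fun _ _ => by simp only [Prod.mk.injEq]; tauto
  have hYSX := entropy_congr q (X := fun ω => (X ω, Y ω, S ω))
    (Y := fun ω => (Y ω, S ω, X ω)) fun _ _ => by simp only [Prod.mk.injEq]; tauto
  have hYS := entropy_congr q (X := fun ω => (Y ω, S ω))
    (Y := fun ω => (S ω, Y ω)) fun _ _ => by simp only [Prod.mk.injEq]; tauto
  linarith

end InformationIdentities

section Past

variable {Ω A B C : Type*} {n : ℕ}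

/-- The first `k` letters of the sequence `Z (x 0), Z (x 1), …`, as a sequence of the full
length `n` padded with `none`, so that its type does not depend on `k`. -/
def past (Z : Ω → A) (k : ℕ) (x : Fin n → Ω) : Fin n → Option A :=
  fun j => if j.val < k then some (Z (x j)) else none

theorem past_eq_iff {Z : Ω → A} {k : ℕ} {x x' : Fin n → Ω} :
    past Z k x = past Z k x' ↔ ∀ j : Fin n, j.val < k → Z (x j) = Z (x' j) := by
  rw [funext_iff]
  refine forall_congr' fun j => ?_
  by_cases h : j.val < k <;> simp [past, h]

theorem past_succ_eq_iff {Z : Ω → A} {i : Fin n} {x x' : Fin n → Ω} :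
    past Z (i + 1) x = past Z (i + 1) x' ↔ Z (x i) = Z (x' i) ∧ past Z i x = past Z i x' := by
  simp only [past_eq_iff, Nat.lt_succ_iff_lt_or_eq, ← Fin.ext_iff, or_imp, forall_and, forall_eq]
  exact and_comm

variable [Fintype Ω]

theorem isMarkovChain_coord (n : ℕ) (p : Ω → ℝ) (X : Ω → A) (Y : Ω → B) (i : Fin n) :
    IsMarkovChain (iidMass n p) (fun x => Y (x i)) (fun x => X (x i)) fun x j => X (x j) := by
  have hcoord (j : Fin n) : IsMarkovChain p (fun ω => if j = i then some (Y ω) else none)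
      (fun ω => if j = i then some (X ω) else none) X := by
    by_cases hj : j = i
    · exact isMarkovChain_of_determines _ fun ω ω' => by simp [hj]
    · exact (isMarkovChain_of_determines _ fun ω ω' => by simp [hj]).symm
  refine IsMarkovChain.of_injective (f := fun b (j : Fin n) => if j = i then some b else none)
    (g := fun a (j : Fin n) => if j = i then some a else none)
    (fun _ _ h => by simpa using congrFun h i) (fun _ _ h => by simpa using congrFun h i) ?_
  convert IsMarkovChain.iidMass hcoord using 5 <;> subst_vars <;> rfl

variable [Fintype A] [Fintype B] [Fintype C]

theorem sum_condEntropy_past {Q : (Fin n → Ω) → ℝ} (hQ : ∀ x, 0 ≤ Q x) (Z : Ω → A)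
    (S : (Fin n → Ω) → C) :
    ∑ i, condEntropy Q (fun x => Z (x i)) (fun x => (S x, past Z i x)) =
      condEntropy Q (fun x j => Z (x j)) S := by
  set H : ℕ → ℝ := fun k => entropy Q fun x => (S x, past Z k x)
  have hstep (i : Fin n) :
      condEntropy Q (fun x => Z (x i)) (fun x => (S x, past Z i x)) = H (i + 1) - H i := by
    rw [condEntropy_eq hQ]
    congr 1
    exact entropy_congr Q fun x x' => by
      simp only [Prod.mk.injEq, past_succ_eq_iff]
      tauto
  have hH0 : H 0 = entropy Q S := entropy_congr Q fun x x' => by simp [past_eq_iff]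
  have hHn : H n = entropy Q fun x => ((fun j => Z (x j)), S x) := entropy_congr Q fun x x' => by
    simp only [Prod.mk.injEq, past_eq_iff, Fin.is_lt, forall_const, funext_iff (f := fun _ => Z _),
      and_comm]
  simp only [hstep]
  rw [Fin.sum_univ_eq_sum_range (fun k => H (k + 1) - H k), Finset.sum_range_sub, hHn, hH0,
    condEntropy_eq hQ]

theorem condEntropy_past_le {p : Ω → ℝ} (hp : p ∈ stdSimplex ℝ Ω) (X : Ω → A) (Y : Ω → B)
    (s : (Fin n → A) → C) (i : Fin n) :
    condEntropy (iidMass n p) (fun x => Y (x i))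
        (fun x => (s fun j => X (x j), past X i x)) ≤
      condEntropy (iidMass n p) (fun x => Y (x i))
        (fun x => (s fun j => X (x j), past Y i x)) := by
  have hQ := iidMass_mem_stdSimplex n hp
  have hcoord (j : Fin n) : IsMarkovChain p (fun ω => if j.val < i then some (Y ω) else none)
      (fun ω => if j.val < i then some (X ω) else none)
      fun ω => (X ω, if j = i then some (Y ω) else none) := by
    by_cases hj : j.val < i
    · exact isMarkovChain_of_determines _ fun ω ω' => by
        simp [hj, Fin.ne_of_lt (Fin.lt_def.mpr hj)]
    · exact (isMarkovChain_of_determines _ fun ω ω' => by simp [hj]).symm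
  have hblock : IsMarkovChain (iidMass n p) (past Y i) (past X i) fun x =>
      (s fun j => X (x j), some (Y (x i))) := by
    have h := (IsMarkovChain.iidMass hcoord).comp_right fun z => (s fun j => (z j).1, (z i).2)
    simp only [if_true] at h
    exact h
  calc _ = condEntropy (iidMass n p) (fun x => some (Y (x i)))
          (fun x => (s fun j => X (x j), past X i x)) :=
        condEntropy_congr hQ.1 (by simp) fun _ _ => Iff.rfl
    _ ≤ condEntropy (iidMass n p) (fun x => some (Y (x i)))
          (fun x => (s fun j => X (x j), past Y i x)) := hblock.condEntropy_le hQ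
    _ = _ := condEntropy_congr hQ.1 (by simp) fun _ _ => Iff.rfl

end Past

section TimeSharing

variable {Ω A B C D : Type*} {n : ℕ}

/-- The joint law of a uniformly distributed time index `J : Fin n` and an independent random
element with mass function `Q`; it turns averages over the `n` letters of a block into
information quantities conditioned on `J`. -/
noncomputable def timeMass (n : ℕ) (Q : Ω → ℝ) (t : Fin n × Ω) : ℝ := 1 / n * Q t.2

variable [Fintype Ω]

theorem timeMass_mem_stdSimplex (hn : n ≠ 0) {Q : Ω → ℝ} (hQ : Q ∈ stdSimplex ℝ Ω) :
    timeMass n Q ∈ stdSimplex ℝ (Fin n × Ω) := by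
  refine ⟨fun t => mul_nonneg (by positivity) (hQ.1 _), ?_⟩
  simp [timeMass, Fintype.sum_prod_type, ← Finset.mul_sum, hQ.2, hn]

theorem law_timeMass (Q : Ω → ℝ) (W : Fin n → Ω → A) (a : A) :
    law (timeMass n Q) (fun t => W t.1 t.2) a = 1 / n * ∑ i, law Q (W i) a := by
  simp [law, timeMass, Fintype.sum_prod_type, Finset.mul_sum, mul_ite]

theorem law_timeMass_pair (Q : Ω → ℝ) (V : Fin n → Ω → A) (i : Fin n) (a : A) :
    law (timeMass n Q) (fun t => (t.1, V t.1 t.2)) (i, a) = 1 / n * law Q (V i) a := by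
  classical
  rw [law_timeMass Q fun j ω => (j, V j ω)]
  congr 1
  rw [Finset.sum_eq_single i (fun j _ hj => by simp [law, hj]) (by simp)]
  exact law_congr Q fun ω => by simp

theorem condLaw_timeMass (hn : n ≠ 0) (Q : Ω → ℝ) (W : Fin n → Ω → A) (V : Fin n → Ω → B)
    (i : Fin n) (b : B) :
    condLaw (timeMass n Q) (fun t => W t.1 t.2) (fun t => (t.1, V t.1 t.2)) (i, b) =
      condLaw Q (W i) (V i) b := by
  funext a
  rw [condLaw, law_timeMass_pair, law_congr _ (Y := fun t => (t.1, W t.1 t.2, V t.1 t.2))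
    (b := (i, a, b)) fun t => by simp [and_left_comm],
    law_timeMass_pair Q fun j ω => (W j ω, V j ω), mul_div_mul_left _ _ (by positivity), condLaw]

theorem condEntropy_timeMass [Fintype A] [Fintype B] (hn : n ≠ 0) (Q : Ω → ℝ)
    (W : Fin n → Ω → A) (V : Fin n → Ω → B) :
    condEntropy (timeMass n Q) (fun t => W t.1 t.2) (fun t => (t.1, V t.1 t.2)) =
      1 / n * ∑ i, condEntropy Q (W i) (V i) := by
  simp only [condEntropy_eq_sum, condLaw_timeMass hn, Fintype.sum_prod_type, timeMass,
    mul_assoc, Finset.mul_sum]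

theorem law_iidMass_coord (n : ℕ) {p : Ω → ℝ} (hp : p ∈ stdSimplex ℝ Ω) (X : Ω → A) (i : Fin n) :
    law (iidMass n p) (fun x => X (x i)) = law p X := by
  classical
  funext a
  calc law (iidMass n p) (fun x => X (x i)) a
      = ∑ x, iidMass n p x * if X (x i) = a then 1 else 0 := prob_eq_sum_mul _ _
    _ = ∑ ω, p ω * if X ω = a then 1 else 0 :=
        sum_iidMass_mul_coord n hp i fun ω => if X ω = a then 1 else 0
    _ = law p X a := (prob_eq_sum_mul _ _).symm

variable {p : Ω → ℝ}

theorem law_timeMass_coord (hn : n ≠ 0) (hp : p ∈ stdSimplex ℝ Ω) (X : Ω → A) :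
    law (timeMass n (iidMass n p)) (fun t => X (t.2 t.1)) = law p X := by
  funext a
  rw [law_timeMass (iidMass n p) fun i x => X (x i)]
  simp [law_iidMass_coord n hp, hn]

theorem isMarkovChain_timeMass [Finite A] (hn : n ≠ 0) (hp : p ∈ stdSimplex ℝ Ω) (X : Ω → A)
    (Y : Ω → B) (s : Fin n → (Fin n → A) → C) :
    IsMarkovChain (timeMass n (iidMass n p)) (fun t => Y (t.2 t.1)) (fun t => X (t.2 t.1))
      fun t => (t.1, s t.1 fun j => X (t.2 j)) := by
  rintro y x ⟨i, c⟩
  have h := (isMarkovChain_coord n p X Y i).comp_right (s i) y x c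
  rw [law_iidMass_coord n hp fun ω => (Y ω, X ω), law_iidMass_coord n hp] at h
  have hYXZ : law (timeMass n (iidMass n p))
      (fun t => (Y (t.2 t.1), X (t.2 t.1), t.1, s t.1 fun j => X (t.2 j))) (y, x, i, c) =
      1 / n * law (iidMass n p) (fun x => (Y (x i), X (x i), s i fun j => X (x j))) (y, x, c) := by
    rw [← law_timeMass_pair (iidMass n p) fun i x => (Y (x i), X (x i), s i fun j => X (x j))]
    exact law_congr _ fun t => by simp only [Prod.mk.injEq]; tauto
  have hXZ : law (timeMass n (iidMass n p))
      (fun t => (X (t.2 t.1), t.1, s t.1 fun j => X (t.2 j))) (x, i, c) =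
      1 / n * law (iidMass n p) (fun x => (X (x i), s i fun j => X (x j))) (x, c) := by
    rw [← law_timeMass_pair (iidMass n p) fun i x => (X (x i), s i fun j => X (x j))]
    exact law_congr _ fun t => by simp only [Prod.mk.injEq]; tauto
  rw [hYXZ, hXZ, law_timeMass_coord hn hp, law_timeMass_coord hn hp fun ω => (Y ω, X ω),
    mul_assoc, h]
  ring

variable [Fintype A] [Fintype B] [Fintype C] [Fintype D]

theorem condEntropy_timeMass_past (hn : n ≠ 0) (hp : p ∈ stdSimplex ℝ Ω) (X : Ω → A)
    (S : (Fin n → Ω) → C) :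
    condEntropy (timeMass n (iidMass n p)) (fun t => X (t.2 t.1))
        (fun t => (t.1, S t.2, past X t.1 t.2)) =
      1 / n * condEntropy (iidMass n p) (fun x j => X (x j)) S := by
  rw [condEntropy_timeMass hn (iidMass n p) (fun i x => X (x i)) fun i x => (S x, past X i x),
    sum_condEntropy_past (iidMass_mem_stdSimplex n hp).1]

theorem mutualInfo_timeMass_past (hn : n ≠ 0) (hp : p ∈ stdSimplex ℝ Ω) (X : Ω → A)
    (T : (Fin n → Ω) → C) :
    mutualInfo (timeMass n (iidMass n p)) (fun t => X (t.2 t.1))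
        (fun t => (t.1, T t.2, past X t.1 t.2)) =
      1 / n * mutualInfo (iidMass n p) (fun x j => X (x j)) T := by
  have hQ := iidMass_mem_stdSimplex n hp
  have hletter : entropy (timeMass n (iidMass n p)) (fun t => X (t.2 t.1)) = entropy p X :=
    (entropy_law _ _ id).symm.trans <|
      (congrArg (entropy · id) (law_timeMass_coord hn hp X)).trans (entropy_law p X id)
  have hblock : entropy (iidMass n p) (fun x j => X (x j)) = n * entropy p X := by
    simpa using entropy_iidMass n hp fun _ => X
  rw [mutualInfo_eq_sub_condEntropy (timeMass_mem_stdSimplex hn hQ).1,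
    mutualInfo_eq_sub_condEntropy hQ.1, condEntropy_timeMass_past hn hp, hletter, hblock]
  field_simp

theorem condMutualInfo_timeMass_past (hn : n ≠ 0) (hp : p ∈ stdSimplex ℝ Ω) (X : Ω → A)
    (T : (Fin n → Ω) → C) (T' : (Fin n → Ω) → D) :
    condMutualInfo (timeMass n (iidMass n p)) (fun t => X (t.2 t.1)) (fun t => T' t.2)
        (fun t => (t.1, T t.2, past X t.1 t.2)) =
      1 / n * condMutualInfo (iidMass n p) (fun x j => X (x j)) T' T := by
  have hQ := iidMass_mem_stdSimplex n hp
  have hμ := timeMass_mem_stdSimplex hn hQ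
  have hcomm := condEntropy_congr hμ.1 (X := fun t => X (t.2 t.1)) (fun _ _ => Iff.rfl)
    (Y := fun t => (T' t.2, t.1, T t.2, past X t.1 t.2))
    (Y' := fun t => (t.1, (T' t.2, T t.2), past X t.1 t.2))
    fun _ _ => by simp only [Prod.mk.injEq]; tauto
  rw [condMutualInfo_eq_sub_condEntropy hμ.1, condMutualInfo_eq_sub_condEntropy hQ.1, hcomm,
    condEntropy_timeMass_past hn hp, condEntropy_timeMass_past hn hp X fun x => (T' x, T x),
    mul_sub]

theorem condEntropy_timeMass_past_le (hn : n ≠ 0) (hp : p ∈ stdSimplex ℝ Ω) (X : Ω → A)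
    (Y : Ω → B) (s : (Fin n → A) → C) :
    condEntropy (timeMass n (iidMass n p)) (fun t => Y (t.2 t.1))
        (fun t => (t.1, (s fun j => X (t.2 j)), past X t.1 t.2)) ≤
      1 / n * condEntropy (iidMass n p) (fun x j => Y (x j)) (fun x => s fun j => X (x j)) := by
  rw [← condEntropy_timeMass_past hn hp,
    condEntropy_timeMass hn (iidMass n p) (fun i x => Y (x i)) fun i x =>
      (s fun j => X (x j), past X i x),
    condEntropy_timeMass hn (iidMass n p) (fun i x => Y (x i)) fun i x =>
      (s fun j => X (x j), past Y i x)]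
  gcongr with i
  exact condEntropy_past_le hp X Y s i

end TimeSharing

section Union

variable {Ω 𝒳₀ 𝒳₁ 𝒳₂ 𝒰₀ 𝒰₁ 𝒰₂ : Type*} [Fintype Ω] [Fintype 𝒳₀] [Fintype 𝒳₁] [Fintype 𝒳₂]
  [Fintype 𝒰₀] [Fintype 𝒰₁] [Fintype 𝒰₂]

theorem mem_infoRegionUnion {p : 𝒳₀ × 𝒳₁ × 𝒳₂ → ℝ} {μ : Ω → ℝ} (hμ : μ ∈ stdSimplex ℝ Ω)
    {X : Ω → 𝒳₀ × 𝒳₁ × 𝒳₂} (hX : law μ X = p) {U₀ : Ω → 𝒰₀} {U₁ : Ω → 𝒰₁} {U₂ : Ω → 𝒰₂}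
    (h₁ : IsMarkovChain μ (fun ω => (X ω).2.1) (fun ω => (X ω).1)
      fun ω => (U₀ ω, U₁ ω, U₂ ω))
    (h₂ : IsMarkovChain μ (fun ω => (X ω).2.2) (fun ω => (X ω).1)
      fun ω => (U₀ ω, U₁ ω, U₂ ω)) {R : Packet → ℝ}
    (hR₀₁₂ : mutualInfo μ (fun ω => (X ω).1) U₀ ≤ R .p012)
    (hR₀₁ : condMutualInfo μ (fun ω => (X ω).1) U₁ U₀ ≤ R .p01)
    (hR₀₂ : condMutualInfo μ (fun ω => (X ω).1) U₂ U₀ ≤ R .p02)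
    (hR₁ : condEntropy μ (fun ω => (X ω).2.1) (fun ω => (U₀ ω, U₁ ω)) ≤ R .p1)
    (hR₂ : condEntropy μ (fun ω => (X ω).2.2) (fun ω => (U₀ ω, U₂ ω)) ≤ R .p2) :
    R ∈ infoRegionUnion p := by
  -- `infoRegionUnion` only allows auxiliaries in `Type`, so the values of `Uᵢ` are enumerated.
  set e₀ := Fintype.equivFin 𝒰₀
  set e₁ := Fintype.equivFin 𝒰₁
  set e₂ := Fintype.equivFin 𝒰₂
  set V := fun ω => (e₀ (U₀ ω), e₁ (U₁ ω), e₂ (U₂ ω))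
  have hq := law_nonneg hμ.1 fun ω => (X ω, V ω)
  refine ⟨_, _, _, inferInstance, inferInstance, inferInstance, law μ fun ω => (X ω, V ω),
    ⟨⟨hq, by rw [sum_law, hμ.2]⟩, fun x => by rw [sum_law_pair_left, hX],
      isMarkovChain_law_iff.mpr (h₁.comp_right (Prod.map e₀ (Prod.map e₁ e₂))),
      isMarkovChain_law_iff.mpr (h₂.comp_right (Prod.map e₀ (Prod.map e₁ e₂)))⟩,
    ?_, ?_, ?_, ?_, ?_⟩
  · refine (mutualInfo_law μ ..).trans_le (hR₀₁₂.trans_eq' ?_)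
    exact mutualInfo_congr hμ.1 (by simp) (by simp [V])
  · refine (condMutualInfo_law μ ..).trans_le (hR₀₁.trans_eq' ?_)
    exact condMutualInfo_congr hμ.1 (by simp) (by simp [V]) (by simp [V])
  · refine (condMutualInfo_law μ ..).trans_le (hR₀₂.trans_eq' ?_)
    exact condMutualInfo_congr hμ.1 (by simp) (by simp [V]) (by simp [V])
  · refine (condEntropy_law μ ..).trans_le (hR₁.trans_eq' ?_)
    exact condEntropy_congr hμ.1 (by simp) (by simp [V])
  · refine (condEntropy_law μ ..).trans_le (hR₂.trans_eq' ?_)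
    exact condEntropy_congr hμ.1 (by simp) (by simp [V])

end Union

section RateBounds

variable {Ω A B C D E : Type*} [Fintype Ω] [Fintype A] [Fintype B] [Fintype C] [Fintype D]
  [Fintype E] {n : ℕ} {p : Ω → ℝ}

theorem mutualInfo_timeMass_le (hn : n ≠ 0) (hp : p ∈ stdSimplex ℝ Ω) (X : Ω → A)
    (T : (Fin n → Ω) → C) :
    mutualInfo (timeMass n (iidMass n p)) (fun t => X (t.2 t.1))
        (fun t => (t.1, T t.2, past X t.1 t.2)) ≤ 1 / n * Real.logb 2 (Fintype.card C) := by
  have hQ := iidMass_mem_stdSimplex n hp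
  rw [mutualInfo_timeMass_past hn hp]
  gcongr
  exact (mutualInfo_le_entropy hQ.1 _ T).trans (entropy_le_logb_card hQ T)

theorem condMutualInfo_timeMass_le (hn : n ≠ 0) (hp : p ∈ stdSimplex ℝ Ω) (X : Ω → A)
    (T : (Fin n → Ω) → C) (T' : (Fin n → Ω) → D) :
    condMutualInfo (timeMass n (iidMass n p)) (fun t => X (t.2 t.1)) (fun t => T' t.2)
        (fun t => (t.1, T t.2, past X t.1 t.2)) ≤ 1 / n * Real.logb 2 (Fintype.card D) := by
  have hQ := iidMass_mem_stdSimplex n hp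
  rw [condMutualInfo_timeMass_past hn hp]
  gcongr
  exact (condMutualInfo_le_entropy hQ _ T' T).trans (entropy_le_logb_card hQ T')

theorem condEntropy_timeMass_le (hn : n ≠ 0) (hp : p ∈ stdSimplex ℝ Ω) (X : Ω → A) (Y : Ω → B)
    (s : (Fin n → A) → C) (s' : (Fin n → A) → D) (T : (Fin n → Ω) → E)
    (d : C → D → E → Fin n → B) :
    condEntropy (timeMass n (iidMass n p)) (fun t => Y (t.2 t.1))
        (fun t => ((t.1, (s fun j => X (t.2 j)), past X t.1 t.2), s' fun j => X (t.2 j))) ≤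
      1 / n * Real.logb 2 (Fintype.card E) + (1 / n +
        prob (iidMass n p) (fun x => (fun j => Y (x j)) ≠
          d (s fun j => X (x j)) (s' fun j => X (x j)) (T x)) *
          Real.logb 2 (Fintype.card B)) := by
  have hQ := iidMass_mem_stdSimplex n hp
  have hn' : (n : ℝ) ≠ 0 := mod_cast hn
  have hfano := condEntropy_le_entropy_add_prob_ne_mul hQ (fun x j => Y (x j))
    (fun x => (s fun j => X (x j), s' fun j => X (x j))) T fun c => d c.1 c.2
  rw [Fintype.card_fun, Fintype.card_fin, Nat.cast_pow, Real.logb_pow] at hfano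
  calc _ = condEntropy (timeMass n (iidMass n p)) (fun t => Y (t.2 t.1)) (fun t =>
          (t.1, (s fun j => X (t.2 j), s' fun j => X (t.2 j)), past X t.1 t.2)) :=
        condEntropy_congr (timeMass_mem_stdSimplex hn hQ).1 (fun _ _ => Iff.rfl) fun _ _ => by
          simp only [Prod.mk.injEq]; tauto
    _ ≤ 1 / n * condEntropy (iidMass n p) (fun x j => Y (x j))
          (fun x => (s fun j => X (x j), s' fun j => X (x j))) :=
        condEntropy_timeMass_past_le hn hp X Y fun z => (s z, s' z)
    _ ≤ 1 / n * (Real.logb 2 (Fintype.card E) + (1 + _ * (n * Real.logb 2 (Fintype.card B)))) := by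
        gcongr
        exact hfano.trans (by gcongr; exact entropy_le_logb_card hQ T)
    _ = _ := by field_simp

end RateBounds

section Converse

open Filter Topology

variable {𝒳₀ 𝒳₁ 𝒳₂ : Type*} [Fintype 𝒳₀] [Fintype 𝒳₁] [Fintype 𝒳₂] {p : 𝒳₀ × 𝒳₁ × 𝒳₂ → ℝ}

theorem Code.isMarkovChain_timeMass {B : Type*} {n : ℕ} (hn : n ≠ 0)
    (hp : p ∈ stdSimplex ℝ (𝒳₀ × 𝒳₁ × 𝒳₂)) (c : Code n 𝒳₀ 𝒳₁ 𝒳₂) (Y : 𝒳₀ × 𝒳₁ × 𝒳₂ → B) :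
    IsMarkovChain (timeMass n (iidMass n p)) (fun t => Y (t.2 t.1)) (fun t => (t.2 t.1).1)
      fun t => ((t.1, (c.enc₀ fun j => (t.2 j).1).1, past Prod.fst t.1 t.2),
        (c.enc₀ fun j => (t.2 j).1).2) :=
  (HelperDIR.isMarkovChain_timeMass hn hp Prod.fst Y fun i z => (c.enc₀ z, past id i z)).comp_right
    fun w => ((w.1, w.2.1.1, w.2.2), w.2.1.2)

theorem Code.mem_infoRegionUnion {n : ℕ} (hn : n ≠ 0)
    (hp : p ∈ stdSimplex ℝ (𝒳₀ × 𝒳₁ × 𝒳₂)) (c : Code n 𝒳₀ 𝒳₁ 𝒳₂) {R : Packet → ℝ}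
    (h₀₁₂ : 1 / n * Real.logb 2 (c.L .p012) ≤ R .p012)
    (h₀₁ : 1 / n * Real.logb 2 (c.L .p01) ≤ R .p01)
    (h₀₂ : 1 / n * Real.logb 2 (c.L .p02) ≤ R .p02)
    (h₁ : 1 / n * Real.logb 2 (c.L .p1) + (1 / n +
      prob (iidMass n p) (fun x => (fun i => (x i).2.1) ≠ c.est₁ x) *
        Real.logb 2 (Fintype.card 𝒳₁)) ≤ R .p1)
    (h₂ : 1 / n * Real.logb 2 (c.L .p2) + (1 / n +
      prob (iidMass n p) (fun x => (fun i => (x i).2.2) ≠ c.est₂ x) *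
        Real.logb 2 (Fintype.card 𝒳₂)) ≤ R .p2) :
    R ∈ infoRegionUnion p := by
  refine HelperDIR.mem_infoRegionUnion (X := fun t => t.2 t.1)
    (timeMass_mem_stdSimplex hn (iidMass_mem_stdSimplex n hp))
    ((law_timeMass_coord hn hp fun x => x).trans (law_id p))
    (c.isMarkovChain_timeMass hn hp fun x => x.2.1) (c.isMarkovChain_timeMass hn hp fun x => x.2.2)
    ?_ ?_ ?_ ?_ ?_
  · refine le_trans ?_ h₀₁₂
    simpa using mutualInfo_timeMass_le hn hp Prod.fst fun x => (c.enc₀ fun j => (x j).1).1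
  · refine le_trans ?_ h₀₁
    simpa using condMutualInfo_timeMass_le hn hp Prod.fst
      (fun x => (c.enc₀ fun j => (x j).1).1) fun x => (c.enc₀ fun j => (x j).1).2.1
  · refine le_trans ?_ h₀₂
    simpa using condMutualInfo_timeMass_le hn hp Prod.fst
      (fun x => (c.enc₀ fun j => (x j).1).1) fun x => (c.enc₀ fun j => (x j).1).2.2
  · refine le_trans ?_ h₁
    simpa [Code.est₁] using condEntropy_timeMass_le hn hp Prod.fst (fun x => x.2.1)
      (fun z => (c.enc₀ z).1) (fun z => (c.enc₀ z).2.1)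
      (fun x => c.enc₁ fun j => (x j).2.1) fun a b t => c.dec₁ (a, b, t)
  · refine le_trans ?_ h₂
    simpa [Code.est₂] using condEntropy_timeMass_le hn hp Prod.fst (fun x => x.2.2)
      (fun z => (c.enc₀ z).1) (fun z => (c.enc₀ z).2.2)
      (fun x => c.enc₂ fun j => (x j).2.2) fun a b t => c.dec₂ (a, b, t)

theorem Achievable.add_const_mem_infoRegionUnion (hp : p ∈ stdSimplex ℝ (𝒳₀ × 𝒳₁ × 𝒳₂))
    {R : Packet → ℝ} (hR : Achievable p R) {δ : ℝ} (hδ : 0 < δ) :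
    (fun k => R k + δ) ∈ infoRegionUnion p := by
  have hsmall (l : ℝ) : ∀ᶠ ε : ℝ in 𝓝[>] 0, 2 * ε * l < δ / 4 := by
    have h : Continuous fun ε : ℝ => 2 * ε * l := by fun_prop
    exact nhdsWithin_le_nhds (h.tendsto 0 |>.eventually_lt_const (by simpa using hδ))
  obtain ⟨ε, hε₁, hε₂, hε, hε1⟩ := ((hsmall (Real.logb 2 (Fintype.card 𝒳₁))).and <|
    (hsmall (Real.logb 2 (Fintype.card 𝒳₂))).and <| Ioo_mem_nhdsGT one_pos).exists
  have hlarge : ∀ᶠ n : ℕ in atTop, 1 / (n : ℝ) ≤ δ / 4 :=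
    (tendsto_const_div_atTop_nhds_zero_nat 1).eventually_le_const (by positivity)
  obtain ⟨n, ⟨c, hc, herr⟩, hn, hn0⟩ := ((hR (δ / 2) (half_pos hδ) ε hε hε1).and <|
    hlarge.and (eventually_ne_atTop 0)).exists
  rw [Code.errorProb_eq] at herr
  have hQ := iidMass_mem_stdSimplex n hp
  set P₁ := prob (iidMass n p) fun x => (fun i => (x i).2.1) ≠ c.est₁ x
  have hP₁ : 0 ≤ P₁ := prob_nonneg hQ.1 _
  set P₂ := prob (iidMass n p) fun x => (fun i => (x i).2.2) ≠ c.est₂ x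
  have hP₂ : 0 ≤ P₂ := prob_nonneg hQ.1 _
  have hfano {P : ℝ} {m : ℕ} (hm : 2 * ε * Real.logb 2 m < δ / 4) (hP : P ≤ 2 * ε) :
      1 / (n : ℝ) + P * Real.logb 2 m ≤ δ / 2 := by
    have hlog : 0 ≤ Real.logb 2 m :=
      div_nonneg (Real.log_natCast_nonneg m) (Real.log_nonneg one_le_two)
    linarith [mul_le_mul_of_nonneg_right hP hlog]
  refine c.mem_infoRegionUnion hn0 hp ?_ ?_ ?_ ?_ ?_
  · linarith [hc .p012]
  · linarith [hc .p01]
  · linarith [hc .p02]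
  · linarith [hc .p1, hfano (P := P₁) hε₁ (by linarith)]
  · linarith [hc .p2, hfano (P := P₂) hε₂ (by linarith)]

theorem isClosed_rateRegion (p : 𝒳₀ × 𝒳₁ × 𝒳₂ → ℝ) : IsClosed (rateRegion p) := by
  rw [← closure_subset_iff_isClosed]
  intro R hR η hη ε hε hε1
  have hnear : ∀ᶠ R' in 𝓝 R, ∀ k, R' k < R k + η / 2 := by
    have h (k : Packet) : ∀ᶠ R' : Packet → ℝ in 𝓝 R, R' k < R k + η / 2 :=
      (continuous_apply k).continuousAt.eventually_lt_const (by linarith)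
    filter_upwards [h .p012, h .p01, h .p02, h .p1, h .p2] with R' h₀₁₂ h₀₁ h₀₂ h₁ h₂
    rintro (_ | _ | _ | _ | _) <;> assumption
  obtain ⟨R', hR', hlt⟩ := ((mem_closure_iff_frequently.mp hR).and_eventually hnear).exists
  filter_upwards [hR' (η / 2) (half_pos hη) ε hε hε1] with n ⟨c, hc, herr⟩
  exact ⟨c, fun k => (hc k).trans (by linarith [hlt k]), herr⟩

theorem rateRegion_eq_closure (hp : p ∈ stdSimplex ℝ (𝒳₀ × 𝒳₁ × 𝒳₂)) :
    rateRegion p = closure (infoRegionUnion p) := by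
  refine subset_antisymm (fun R hR => ?_) (closure_minimal ?_ (isClosed_rateRegion p))
  · have hlim : Tendsto (fun (δ : ℝ) k => R k + δ) (𝓝[>] 0) (𝓝 R) := by
      have h : Continuous fun (δ : ℝ) k => R k + δ := by fun_prop
      simpa using (h.tendsto 0).mono_left nhdsWithin_le_nhds
    exact mem_closure_of_tendsto hlim <| eventually_mem_nhdsWithin.mono fun δ hδ =>
      Achievable.add_const_mem_infoRegionUnion hp hR hδ
  · rintro R ⟨𝒱₀, 𝒱₁, 𝒱₂, _, _, _, q, hq, hR⟩
    exact hq.achievable hR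

end Converse

end HelperDIR

theorem theorem3 {𝒳₀ 𝒳₁ 𝒳₂ : Type*} [Fintype 𝒳₀] [Fintype 𝒳₁] [Fintype 𝒳₂]
    (p : 𝒳₀ × 𝒳₁ × 𝒳₂ → ℝ) (hp : p ∈ stdSimplex ℝ (𝒳₀ × 𝒳₁ × 𝒳₂)) :
    (∀ (𝒰₀ 𝒰₁ 𝒰₂ : Type*) [Fintype 𝒰₀] [Fintype 𝒰₁] [Fintype 𝒰₂]
        (q : (𝒳₀ × 𝒳₁ × 𝒳₂) × (𝒰₀ × 𝒰₁ × 𝒰₂) → ℝ), HelperDIR.IsAuxiliary p q →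
        ∀ R ∈ HelperDIR.infoRegion q, HelperDIR.Achievable p R) ∧
      HelperDIR.rateRegion p = closure (HelperDIR.infoRegionUnion p) :=
  ⟨fun _ _ _ _ _ _ _ hq _ hR => hq.achievable hR, HelperDIR.rateRegion_eq_closure hp⟩
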